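/- Let $\Gamma$ be a finite normal form game with players $N=\{1,\dots,n\}$ in which all players use the same finite action set $Y$, and let $\Delta$ be the simplex of probability vectors in $\mathbb R^{Y}$; identify $y\in Y$ with the vertex $e_y\in\Delta$. Let $U_i$ be the multilinear extension to $\Delta^n$ of the utility $u_i:Y^n\to\mathbb R$. Assume that the utilities are identical ($u_i=u_j$ for all $i,j$) and permutation invariant (exchanging the actions of any two players does not change them). For $p\in\Delta^n$ put $\bar p=\frac1n\sum_j p_j$, and let $\bar p_{-i}$ consist of $n-1$ copies of $\bar p$. Let $NE$ be the set of mixed Nash equilibria, $$C=\{p\in NE: p_1=\dots=p_n\},\qquad MCE=\{p\in\Delta^n: U_i(p_i,\bar p_{-i})\ge U_i(p_i',\bar p_{-i})\ \ \forall p_i'\in\Delta,\ \forall i\},$$ and let $BR_i^{\varepsilon}(p_{-i})=\{y\in Y: U_i(y,p_{-i})\ge \max_{y'\in Y}U_i(y',p_{-i})-\varepsilon\}$. Let convergence maps $f_i^\xi:\Delta^n\to\Delta$, $i\in N$, be given. The strongly convergent variant of Empirical Centroid Fictitious Play with these maps is the following process in rounds $t=1,2,\dots$. On a probability space there are random variables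 $a_i(t)\in Y$ (the actions), $X_i(t)\in\{0,1\}$ (with $X_i(t)=1$ if player $i$ deliberately plays a best response in round $t$) and $b_i(t)\in Y$. The actions $a_i(1)$ are arbitrary and $X_i(1)=1$. Let $\ell_i(t)=\sum_{s=1}^t X_i(s)$ and $\tau_i(s)=\inf\{t:\ell_i(t)=s\}$, and let $$q_i(t)=\frac1{\ell_i(t)}\sum_{s=1}^{\ell_i(t)}a_i(\tau_i(s)),\qquad \bar q(t)=\frac1n\sum_j q_j(t),\qquad \xi_i(t)=f_i^\xi(q(t)).$$ Let $\mathcal F_t=\sigma(\{a_i(s),X_i(s),b_i(s):1\le s\le t,\ i\in N\})$. For $t\ge2$, $b_i(t-1)\in BR_i^{\eta_t}(\bar q_{-i}(t-1))$, where $(\eta_t)$ is a real sequence, and, conditionally on $\mathcal F_{t-1}$ and $X_i(t)$, the action $a_i(t)$ is drawn from $b_i(t-1)$ if $X_i(t)=1$ and from $\xi_i(t-1)$ if $X_i(t)=0$. Let $\rho_i(t)=\mathbb P(X_i(t)=1\mid\mathcal F_{t-1})$. The mixed strategy of player $i$ in round $t\ge 2$ is $$g_i(t)=b_i(t-1)\rho_i(t)+\xi_i(t-1)(1-\rho_i(t)),\qquad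 g(t)=(g_1(t),\dots,g_n(t)).$$ (Relations between random variables are meant almost surely.) Assume that * A.1: $\rho_i(t)\to0$ as $t\to\infty$, a.s., for all $i$; * A.2: $\sum_{t\ge1}\rho_i(t)=\infty$ a.s., for all $i$; * A.3: $\sum_{k=1}^t\rho_i(k)\big/\sum_{k=1}^t\rho_j(k)\to1$ as $t\to\infty$, a.s., for all $i,j$; * A.10: $\eta_t\to0$ as $t\to\infty$. Let $d$ be the Euclidean distance from a point to a set in $(\mathbb R^{Y})^n$, with $d(\cdot,\emptyset)=\infty$. Then: (i) if $f_i^\xi(q)=\frac1n\sum_j q_j$ for all $i$, then $\lim_{t\to\infty}d(g(t),C)=0$ almost surely; (ii) if $f_i^\xi(q)=q_i$ for all $i$, then $\lim_{t\to\infty}d(g(t),MCE)=0$ almost surely. -/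

import Mathlib

open MeasureTheory Filter Topology
open scoped ENNReal

noncomputable section

namespace ECFP

/-- A finite normal form game with players `1, …, n` in which all players use the same finite
action set `Y`: `Γ.u i y` is the utility of player `i` at the joint action `y`. -/
structure Game (n : ℕ) (Y : Type*) where
  u : Fin n → (Fin n → Y) → ℝ

/-- A tuple of vectors in `ℝ^Y`, one for each player. The set of joint mixed strategies is the
subset `mixedProfiles`. -/
abbrev Profile (n : ℕ) (Y : Type*) := Fin n → Y → ℝ

section Games

variable {n : ℕ} {Y : Type*} [Fintype Y] [DecidableEq Y]

/-- The vertex of the simplex that corresponds to the action `y`. -/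
def pureStrategy (y : Y) : Y → ℝ := Pi.single y 1

variable (n Y) in
/-- The set `Δ^n` of joint mixed strategies. -/
def mixedProfiles : Set (Profile n Y) := {p | ∀ i, p i ∈ stdSimplex ℝ Y}

/-- The mixed utility `U_i(p) = ∑_y u_i(y) p_1(y_1) ⋯ p_n(y_n)`. -/
def Game.mixedUtility (Γ : Game n Y) (i : Fin n) (p : Profile n Y) : ℝ :=
  ∑ y : Fin n → Y, Γ.u i y * ∏ j, p j (y j)

/-- `U_i(x, p_{-i})`: player `i` uses `x`, every other player `j` uses `p j`. The entry `p i`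
plays no role. -/
def Game.deviationUtility (Γ : Game n Y) (i : Fin n) (x : Y → ℝ) (p : Profile n Y) : ℝ :=
  Γ.mixedUtility i (Function.update p i x)

/-- The pure `ε`-best responses of player `i` to the strategies `p j`, `j ≠ i`. -/
def Game.bestResponse (Γ : Game n Y) (ε : ℝ) (i : Fin n) (p : Profile n Y) : Set Y :=
  {y | ∀ y' : Y, Γ.deviationUtility i (pureStrategy y') p - ε ≤
    Γ.deviationUtility i (pureStrategy y) p}

/-- The centroid `(1/n) ∑_j p_j`. -/
def centroid (p : Profile n Y) : Y → ℝ := (1 / (n : ℝ)) • ∑ j, p j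

/-- The set of (mixed) Nash equilibria. -/
def Game.nashEquilibria (Γ : Game n Y) : Set (Profile n Y) :=
  {p | p ∈ mixedProfiles n Y ∧ ∀ i, ∀ x ∈ stdSimplex ℝ Y,
    Γ.deviationUtility i x p ≤ Γ.deviationUtility i (p i) p}

/-- The set `C` of consensus equilibria: Nash equilibria in which all players use the same
strategy. -/
def Game.consensusEquilibria (Γ : Game n Y) : Set (Profile n Y) :=
  {p | p ∈ Γ.nashEquilibria ∧ ∀ i j, p i = p j}

/-- The set `MCE` of mean-centric equilibria. -/
def Game.meanCentricEquilibria (Γ : Game n Y) : Set (Profile n Y) :=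
  {p | p ∈ mixedProfiles n Y ∧ ∀ i, ∀ x ∈ stdSimplex ℝ Y,
    Γ.deviationUtility i x (fun _ => centroid p) ≤
      Γ.deviationUtility i (p i) (fun _ => centroid p)}

/-- All players have the same utility function. -/
def Game.Identical (Γ : Game n Y) : Prop := ∀ i j y, Γ.u i y = Γ.u j y

/-- Exchanging the actions of any two players does not change the utilities. -/
def Game.PermutationInvariant (Γ : Game n Y) : Prop :=
  ∀ k i j y, Γ.u k (fun l => y (Equiv.swap i j l)) = Γ.u k y

/-- A profile as a vector of `ℝ^{n|Y|}` with the Euclidean norm. -/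
def Profile.toEuclidean (p : Profile n Y) : EuclideanSpace ℝ (Fin n × Y) :=
  WithLp.toLp 2 (fun k => p k.1 k.2)

/-- The Euclidean distance from a profile to a set of profiles (`∞` for the empty set). -/
def distToSet (p : Profile n Y) (S : Set (Profile n Y)) : ℝ≥0∞ :=
  Metric.infEDist p.toEuclidean (Profile.toEuclidean '' S)

end Games

/-- The maps that make up an FP-type algorithm: the empirical distribution `f^q_i(H, t)` formed
from an action history of length `t`, the prediction `f^p_i(q)` of the strategies of the opponents
of `i` (only the entries `j ≠ i` are used), and the convergence map `f^ξ_i(q)`. -/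
structure FPAlgorithm (n : ℕ) (Y : Type*) where
  empirical : Fin n → (t : ℕ) → (Fin t → Y) → (Y → ℝ)
  prediction : Fin n → Profile n Y → Profile n Y
  convergence : Fin n → Profile n Y → (Y → ℝ)

section Algorithms

variable {n : ℕ} {Y : Type*} [Fintype Y] [DecidableEq Y]

variable (n Y) in
/-- Empirical Centroid FP with the convergence map `f`: the empirical distribution is the
normalized histogram, the prediction consists of copies of the centroid. -/
def ecfp (f : Fin n → Profile n Y → (Y → ℝ)) : FPAlgorithm n Y where
  empirical _ t H := (1 / (t : ℝ)) • ∑ s, pureStrategy (H s)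
  prediction _ q := fun _ => centroid q
  convergence := f

variable (n Y) in
/-- Empirical Centroid FP whose convergence maps are the centroid. -/
def ecfpCentroid : FPAlgorithm n Y := ecfp n Y (fun _ q => centroid q)

variable (n Y) in
/-- Empirical Centroid FP whose convergence map is the identity. -/
def ecfpIdentity : FPAlgorithm n Y := ecfp n Y (fun i q => q i)

end Algorithms

/-- The random variables of a repeated play in rounds `t = 1, 2, …` (the index `0` is not used):
the actions `a_i(t)`, the indicators `X_i(t)` of deliberate best responses, and the best responses
`b_i(t)` from which the action of round `t + 1` is chosen. -/
structure Play (n : ℕ) (Y : Type*) (Ω : Type*) where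
  a : Fin n → ℕ → Ω → Y
  X : Fin n → ℕ → Ω → ℕ
  b : Fin n → ℕ → Ω → Y

namespace Play

variable {n : ℕ} {Y Ω : Type*} (P : Play n Y Ω)

/-- The number `ℓ_i(t)` of deliberate best responses of player `i` up to round `t`. -/
def count (i : Fin n) (t : ℕ) (ω : Ω) : ℕ := ∑ s ∈ Finset.Icc 1 t, P.X i s ω

/-- The round `τ_i(s)` of the `s`-th deliberate best response of player `i`. -/
def responseTime (i : Fin n) (s : ℕ) (ω : Ω) : ℕ := sInf {t | P.count i t ω = s}

/-- The empirical distribution `q_i(t)`, formed from the history of those actions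
`a_i(τ_i(1)), …, a_i(τ_i(ℓ_i(t)))` that were deliberate best responses. -/
def empirical (Ψ : FPAlgorithm n Y) (t : ℕ) (ω : Ω) : Profile n Y := fun i =>
  Ψ.empirical i (P.count i t ω)
    (fun s : Fin (P.count i t ω) => P.a i (P.responseTime i ((s : ℕ) + 1) ω) ω)

/-- The asymptotic learning distribution `ξ_i(t) = f^ξ_i(q(t))`. -/
def learning (Ψ : FPAlgorithm n Y) (t : ℕ) (ω : Ω) : Profile n Y := fun i =>
  Ψ.convergence i (P.empirical Ψ t ω)

/-- The σ-algebra `F_t` generated by `a_i(s), X_i(s), b_i(s)`, `1 ≤ s ≤ t`, `i = 1, …, n`. -/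
@[reducible] def history (t : ℕ) : MeasurableSpace Ω :=
  ⨆ s ∈ Finset.Icc 1 t, ⨆ i : Fin n,
    MeasurableSpace.comap (P.a i s) ⊤ ⊔ MeasurableSpace.comap (P.X i s) ⊤ ⊔
      MeasurableSpace.comap (P.b i s) ⊤

variable [MeasurableSpace Ω] (μ : Measure Ω)

/-- `ρ_i(t) = P(X_i(t) = 1 | F_{t-1})`, for `t ≥ 1`. -/
def rho (i : Fin n) (t : ℕ) : Ω → ℝ :=
  μ[Set.indicator {ω | P.X i t ω = 1} (fun _ => (1 : ℝ)) | P.history (t - 1)]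

/-- The period-by-period mixed strategies
`g_i(t) = b_i(t-1) ρ_i(t) + ξ_i(t-1) (1 - ρ_i(t))`, for `t ≥ 2`. -/
def strategy [DecidableEq Y] (Ψ : FPAlgorithm n Y) (t : ℕ) (ω : Ω) : Profile n Y := fun i =>
  P.rho μ i t ω • pureStrategy (P.b i (t - 1) ω) +
    (1 - P.rho μ i t ω) • P.learning Ψ (t - 1) ω i

/-- The play `P` is the strongly convergent variant of `Ψ` on the game `Γ`, where `b_i(t-1)` is an
`η_t`-best response to the prediction `f^p_i(q(t-1))`. The last field says that for `t ≥ 1` the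
action `a_i(t+1)` is drawn, conditionally on `F_t` and `X_i(t+1)`, from `b_i(t)` if `X_i(t+1) = 1`
and from `ξ_i(t)` otherwise. -/
structure IsStrongVariant [Fintype Y] [DecidableEq Y] (Γ : Game n Y) (Ψ : FPAlgorithm n Y)
    (η : ℕ → ℝ) : Prop where
  measurable_a : ∀ i t, Measurable[_, ⊤] (P.a i t)
  measurable_X : ∀ i t, Measurable (P.X i t)
  measurable_b : ∀ i t, Measurable[_, ⊤] (P.b i t)
  X_mem : ∀ i t ω, P.X i t ω = 0 ∨ P.X i t ω = 1
  X_one : ∀ i, ∀ᵐ ω ∂μ, P.X i 1 ω = 1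
  best_response : ∀ i t, 1 ≤ t → ∀ᵐ ω ∂μ,
    P.b i t ω ∈ Γ.bestResponse (η (t + 1)) i (Ψ.prediction i (P.empirical Ψ t ω))
  action_rule : ∀ i t, 1 ≤ t → ∀ y : Y,
    μ[Set.indicator {ω | P.a i (t + 1) ω = y} (fun _ => (1 : ℝ)) |
        P.history t ⊔ MeasurableSpace.comap (P.X i (t + 1)) ⊤]
      =ᵐ[μ] fun ω =>
        if P.X i (t + 1) ω = 1 then pureStrategy (P.b i t ω) y else P.learning Ψ t ω i y

end Play

end ECFP

end

/-!
Write `m` for the centroid of the empirical distributions `q_j`, and let the *gap* of player `j` be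
the amount by which `q_j` fails to be a best response when every opponent uses `m` (`Game.gap`). The
gaps are nonnegative, they all vanish exactly at mean-centric equilibria, and their mean is the gap
of `m` itself. By compactness, and since `ρ → 0` makes the mixed strategies approach the learning
distributions, both claims follow once the gaps are known to tend to `0` almost surely.

The function `V(m) = U(m, …, m)` is a potential. By symmetry its derivative is `n U(·, m, …, m)`, so
when each player moves from `q_j` a small fraction `α_j` of the way towards an almost best response,
`V` increases by at least `∑ j, α_j * gap_j`, up to `o(1) * ∑ j, α_j`
(`Game.exists_potential_ascent`). Here `α_j` is `1 / ℓ_j` in the rounds in which player `j` plays a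
best response and `0` in all others, so the clock `∑ α_j` of player `j` is the harmonic number of
`ℓ_j`. A strong law, obtained from an `L²`-bounded martingale and Kronecker's lemma
(`ae_tendsto_sum_div_sum_condExp`), says that `ℓ_j` is asymptotic to `∑ k, ρ_j(k)`. Hence the clocks
of the players diverge and differ by `o(1)`.

The errors `o(1) * ∑ j, α_j` are not summable, so `V` need not converge because of the ascent alone.
Two points settle this (`tendsto_gap_zero`). Adding the vanishing correction
`-∑ j, gap_j * (h_j - h_i)`, where `h_j` is the clock of player `j`, and a small multiple of
`∑ j, (h_j - h_i)` moves all increments to the single clock `h_i`. And `V` takes only countably many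
values at symmetric equilibria, so that the levels near which `∑ j, gap_j` is bounded below are
dense; `V` cannot cross such a level downwards infinitely often, hence it converges, and then the
gaps must tend to `0`.

Countability takes the place of Sard's theorem and is algebraic (`countable_equilibrium_values`): a
derivation of `ℝ` that kills the utilities also kills `V(m)` at a symmetric equilibrium `m`, by the
first-order conditions, and a real number killed by all of these derivations is algebraic over the
countable field generated by the utilities.
-/

noncomputable section

namespace ECFP

/-! ### Values that every derivation kills -/

section Derivations

/-- In characteristic zero some derivation does not kill a given transcendental element `v`: extend
`v` to a transcendence basis `B`; since `L` is formally étale over the polynomial ring in `B`, the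
partial derivative with respect to `v` extends to `L`. -/
theorem exists_derivation_ne_zero_of_transcendental {k L : Type*} [Field k] [CharZero k] [Field L]
    [Algebra k L] {v : L} (hv : Transcendental k v) : ∃ D : Derivation k L L, D v ≠ 0 := by
  classical
  obtain ⟨B, hvB, hB⟩ := exists_isTranscendenceBasis_superset (R := k) (s := ({v} : Set L))
    ((algebraicIndependent_singleton_iff (⟨v, rfl⟩ : ({v} : Set L))).2 hv)
  have hvB : v ∈ B := hvB rfl
  let Q := MvPolynomial B k
  let A := Algebra.adjoin k (Set.range ((↑) : B → L))
  let e : Q ≃ₐ[k] A := hB.1.aevalEquiv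
  let : Algebra Q L := (MvPolynomial.aeval ((↑) : B → L)).toRingHom.toAlgebra
  let : Algebra Q A := e.toRingHom.toAlgebra
  have : IsScalarTower k Q L := IsScalarTower.of_algebraMap_eq fun r => by
    change _ = MvPolynomial.aeval _ (MvPolynomial.C r); simp
  have : IsScalarTower Q A L := IsScalarTower.of_algebraMap_eq fun r => by
    change MvPolynomial.aeval _ r = ((e r : A) : L)
    exact (hB.1.algebraMap_aevalEquiv r).symm
  have : Algebra.FormallyEtale Q A := Algebra.FormallyEtale.of_equiv
    (A := Q) { e with commutes' := fun r => rfl }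
  have : Algebra.FormallyEtale A L := by
    let K := IntermediateField.adjoin k (Set.range ((↑) : B → L))
    open scoped IntermediateField.algebraAdjoinAdjoin in
    have : Algebra.FormallyEtale A K := .of_isLocalization (nonZeroDivisors _)
    have : Algebra.IsAlgebraic K L := hB.isAlgebraic_field
    have : Algebra.FormallyEtale K L := Algebra.FormallyEtale.of_isSeparable _ L
    exact .comp A K L
  have : Algebra.FormallyEtale Q L := .comp Q A L
  let d : Derivation k Q L :=
    MvPolynomial.mkDerivation k (fun b : B => if (b : L) = v then 1 else 0)
  let φ : Ω[L⁄k] →ₗ[L] L :=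
    (d.liftKaehlerDifferential.liftBaseChange L).comp
      (KaehlerDifferential.tensorKaehlerEquivOfFormallyEtale k Q L).symm.toLinearMap
  refine ⟨φ.compDer (KaehlerDifferential.D k L), ?_⟩
  have hX : algebraMap Q L (MvPolynomial.X ⟨v, hvB⟩) = v := by
    change MvPolynomial.aeval _ (MvPolynomial.X _) = v
    simp
  have : φ (KaehlerDifferential.D k L v) = 1 := by
    conv_lhs => rw [← hX]
    simp [φ, KaehlerDifferential.tensorKaehlerEquivOfFormallyEtale_symm_D_algebraMap, d, Q]
  simp [this]

/-- Real numbers that are constants of every derivation over a countable field form a countable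
set, since they are algebraic. -/
theorem countable_of_forall_derivation (k : Subfield ℝ) [Countable k] :
    {v : ℝ | ∀ D : Derivation k ℝ ℝ, D v = 0}.Countable := by
  refine (Algebraic.countable k ℝ).mono fun v hv => ?_
  by_contra h
  obtain ⟨D, hD⟩ := exists_derivation_ne_zero_of_transcendental h
  exact hD (hv D)

/-- A subfield of `ℝ` generated by a finite set is countable. -/
theorem exists_countable_subfield (s : Set ℝ) (hs : s.Finite) :
    ∃ k : Subfield ℝ, Countable k ∧ s ⊆ k := by
  refine ⟨Subfield.closure s, ?_, Subfield.subset_closure⟩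
  have := Subfield.cardinalMk_closure_le_max s
  rw [← Cardinal.mk_le_aleph0_iff]
  exact this.trans (max_le (Cardinal.mk_le_aleph0_iff.2 hs.countable.to_subtype) le_rfl)

end Derivations

/-! ### Perturbed ascent of a potential -/

section PerturbedAscent

/-- Suppose that `v`, up to a vanishing correction `w - v`, increases at rate `G - ε` with respect
to the clock `A`, where `G` is nonnegative, and positive near a dense set of levels of `v`. Then `v`
cannot cross such a level downwards infinitely often; hence it converges. -/
theorem exists_tendsto_of_perturbed_ascent {A v G : ℕ → ℝ} (hA : Monotone A)
    (hstep : Tendsto (fun t => A (t + 1) - A t) atTop (𝓝 0)) (hG : ∀ t, 0 ≤ G t)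
    (hasc : ∀ ε > 0, ∃ w : ℕ → ℝ, Tendsto (fun t => w t - v t) atTop (𝓝 0) ∧
      ∀ᶠ t in atTop, (A (t + 1) - A t) * (G t - ε) ≤ w (t + 1) - w t)
    {B : ℝ} (hv : ∀ t, |v t| ≤ B) {s : Set ℝ} (hs : Dense s)
    (hlevel : ∀ c ∈ s, ∃ κ > 0, ∃ δ > 0, ∀ t, |v t - c| ≤ κ → δ ≤ G t) :
    ∃ l, Tendsto v atTop (𝓝 l) := by
  refine tendsto_of_no_upcrossings hs ?_
    (isBoundedUnder_of ⟨B, fun t => (abs_le.1 (hv t)).2⟩)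
    (isBoundedUnder_of ⟨-B, fun t => (abs_le.1 (hv t)).1⟩)
  rintro a - c hc hac ⟨hlow, hhigh⟩
  obtain ⟨κ₀, hκ₀, δ, hδ, H₀⟩ := hlevel c hc
  -- The strip of radius `κ` around the level `c` is made to lie above `a`.
  obtain ⟨κ, hκ, hκ₁, hκ₂⟩ : ∃ κ > 0, κ ≤ κ₀ ∧ κ ≤ c - a :=
    ⟨min κ₀ (c - a), lt_min hκ₀ (sub_pos.2 hac), min_le_left _ _, min_le_right _ _⟩
  have H : ∀ t, |v t - c| ≤ κ → δ ≤ G t := fun t ht => H₀ t (ht.trans hκ₁)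
  obtain ⟨w, hwv, hw⟩ := hasc δ hδ
  have h1 : ∀ᶠ t in atTop, |w t - v t| < κ / 4 := by
    simpa using (hwv.abs).eventually_lt_const (by simpa using (by positivity : 0 < κ / 4))
  have h2 : ∀ᶠ t in atTop, (A (t + 1) - A t) < κ / (4 * δ) :=
    hstep.eventually_lt_const (by positivity)
  obtain ⟨T, hT⟩ := (h1.and (h2.and hw)).exists_forall_of_atTop
  have hκ' : 0 < κ / (4 * δ) := by positivity
  have key : ∀ t ≥ T, c - κ / 2 ≤ w t → c - κ / 2 ≤ w (t + 1) := by
    intro t ht hwt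
    obtain ⟨e1, e2, e3⟩ := hT t ht
    have e1 := abs_lt.1 e1
    have hα : 0 ≤ A (t + 1) - A t := sub_nonneg.2 (hA t.le_succ)
    by_cases hin : |v t - c| ≤ κ
    · have := mul_nonneg hα (sub_nonneg.2 (H t hin))
      linarith
    · have hvt : c + κ < v t := by
        by_contra hcon
        exact hin (abs_le.2 ⟨by linarith, by linarith⟩)
      have h3 : (A (t + 1) - A t) * δ ≤ κ / 4 := by
        calc (A (t + 1) - A t) * δ ≤ κ / (4 * δ) * δ := by gcongr
          _ = κ / 4 := by field_simp
      have h4 := mul_nonneg hα (hG t)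
      nlinarith
  obtain ⟨t₀, ht₀, hct₀⟩ := (hhigh.and_eventually (eventually_ge_atTop T)).exists
  have hall : ∀ t ≥ t₀, c - κ / 2 ≤ w t := by
    intro t ht
    induction t, ht using Nat.le_induction with
    | base => linarith [abs_lt.1 (hT t₀ hct₀).1]
    | succ t ht ih => exact key t (hct₀.trans ht) ih
  obtain ⟨t, hta, htt⟩ := (hlow.and_eventually (eventually_ge_atTop t₀)).exists
  linarith [abs_lt.1 (hT t (hct₀.trans htt)).1, hall t htt]

/-- If `v` converges and, up to a vanishing correction, increases at rate `G` with respect to the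
clock `A`, and `G` decreases at most at a bounded rate, then `G` tends to `0`: otherwise `v` would
infinitely often increase by a fixed amount. -/
theorem tendsto_zero_of_perturbed_ascent {A v G Z : ℕ → ℝ} {K l : ℝ} (hA : Monotone A)
    (htop : Tendsto A atTop atTop) (hG : ∀ t, 0 ≤ G t)
    (hasc : ∀ ε > 0, ∃ w : ℕ → ℝ, Tendsto (fun t => w t - v t) atTop (𝓝 0) ∧
      ∀ᶠ t in atTop, (A (t + 1) - A t) * (G t - ε) ≤ w (t + 1) - w t)
    (hv : Tendsto v atTop (𝓝 l)) (hK : 0 < K) (hZ : Tendsto Z atTop (𝓝 0))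
    (hlip : Monotone fun t => G t + K * A t + Z t) : Tendsto G atTop (𝓝 0) := by
  rw [Metric.tendsto_atTop]
  by_contra! hcon
  obtain ⟨δ', hδ', hfreq⟩ := hcon
  obtain ⟨δ, hδ, rfl⟩ : ∃ δ > 0, δ' = 4 * δ := ⟨δ' / 4, by positivity, by ring⟩
  obtain ⟨w, hwv, hw⟩ := hasc δ hδ
  have hwl : Tendsto w atTop (𝓝 l) := by simpa using hwv.add hv
  have hpos : 0 < δ * (δ / K) / 4 := by positivity
  have h1 : ∀ᶠ t in atTop, |w t - l| < δ * (δ / K) / 4 := by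
    have := (hwl.sub_const l).abs
    exact this.eventually_lt_const (by simpa using hpos)
  have h2 : ∀ᶠ t in atTop, |Z t| < δ / 2 :=
    hZ.abs.eventually_lt_const (by simpa using (by positivity : 0 < δ / 2))
  obtain ⟨T, hT⟩ := (h1.and (h2.and hw)).exists_forall_of_atTop
  obtain ⟨t, htT, htG⟩ := hfreq T
  have htG : 4 * δ ≤ G t := by simpa [abs_of_nonneg (hG t)] using htG
  -- `m` is the end of the window of length `δ / K` that starts at `t`.
  have hex : ∃ m, A t + δ / K ≤ A m := (htop.eventually_ge_atTop _).exists
  classical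
  set m := Nat.find hex with hm
  have hAm : A t + δ / K ≤ A m := Nat.find_spec hex
  have htm : t ≤ m := by
    by_contra hlt
    have := hA (not_le.1 hlt).le
    have : 0 < δ / K := by positivity
    linarith
  have hgrow : ∀ s, t ≤ s → s ≤ m → δ * (A s - A t) ≤ w s - w t := by
    intro s hts
    induction s, hts using Nat.le_induction with
    | base => simp
    | succ s hts ih =>
      intro hsm
      have hs1 : A s < A t + δ / K := not_le.1 (Nat.find_min hex (Nat.lt_of_succ_le hsm))
      have hs2 := ih (Nat.le_of_succ_le hsm)
      have hs3 := hlip hts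
      simp only at hs3
      have hs4 : K * (A s - A t) ≤ δ := by
        calc K * (A s - A t) ≤ K * (δ / K) := by gcongr; linarith
          _ = δ := by field_simp
      obtain ⟨-, z1, -⟩ := hT t htT
      obtain ⟨-, z2, z3⟩ := hT s (htT.trans hts)
      have z1 := abs_lt.1 z1
      have z2 := abs_lt.1 z2
      have hs5 : 2 * δ ≤ G s := by linarith
      have hα : 0 ≤ A (s + 1) - A s := sub_nonneg.2 (hA s.le_succ)
      have := mul_le_mul_of_nonneg_left (by linarith : δ ≤ G s - δ) hα
      linarith
  have hend := hgrow m htm le_rfl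
  have : δ * (δ / K) ≤ δ * (A m - A t) := by gcongr; linarith
  have e1 := abs_lt.1 (hT t htT).1
  have e2 := abs_lt.1 (hT m (htT.trans htm)).1
  linarith

variable {ι : Type*} [Fintype ι]

/-- Passage from many asymptotically synchronous clocks `h i` to the single clock `h i₀`: the
correction `-∑ i, gap i * (h i - h i₀)` moves the main terms from the clocks `h i` to `h i₀`, and a
small multiple of `∑ i, (h i - h i₀)` does the same for the errors. -/
theorem exists_single_clock_correction (i₀ : ι) {h gap : ι → ℕ → ℝ} {v : ℕ → ℝ} {K B : ℝ}
    (hmono : ∀ i, Monotone (h i))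
    (hsync : ∀ i, Tendsto (fun t => h i t - h i₀ t) atTop (𝓝 0))
    (hgap : ∀ i t, 0 ≤ gap i t) (hgapB : ∀ i t, gap i t ≤ B)
    (hasc : ∀ ε > 0, ∀ᶠ t in atTop,
      ∑ i, (h i (t + 1) - h i t) * (gap i t - ε) ≤ v (t + 1) - v t)
    (hlip : ∀ i t, |gap i (t + 1) - gap i t| ≤ K * ∑ j, (h j (t + 1) - h j t))
    {ε : ℝ} (hε : 0 < ε) :
    ∃ w : ℕ → ℝ, Tendsto (fun t => w t - v t) atTop (𝓝 0) ∧
      ∀ᶠ t in atTop, (h i₀ (t + 1) - h i₀ t) * (∑ i, gap i t - ε) ≤ w (t + 1) - w t := by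
  have hn : 0 < (Fintype.card ι : ℝ) := by
    have : Nonempty ι := ⟨i₀⟩
    exact_mod_cast Fintype.card_pos
  obtain ⟨ε', hε', rfl⟩ : ∃ ε' > 0, ε = 2 * ε' * Fintype.card ι :=
    ⟨ε / (2 * Fintype.card ι), by positivity, by field_simp⟩
  let E : ι → ℕ → ℝ := fun i t => h i t - h i₀ t
  have hE : ∀ i, Tendsto (E i) atTop (𝓝 0) := hsync
  refine ⟨fun t => v t - ∑ i, gap i t * E i t + 2 * ε' * ∑ i, E i t, ?_, ?_⟩
  · have h1 : Tendsto (fun t => ∑ i, gap i t * E i t) atTop (𝓝 0) := by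
      rw [← Finset.sum_const_zero (s := (Finset.univ : Finset ι))]
      refine tendsto_finsetSum _ fun i _ => ?_
      refine squeeze_zero_norm (a := fun t => B * |E i t|) (fun t => ?_)
        (by simpa using ((hE i).abs.const_mul B))
      rw [norm_mul, Real.norm_of_nonneg (hgap i t), Real.norm_eq_abs]
      exact mul_le_mul_of_nonneg_right (hgapB i t) (abs_nonneg _)
    have h2 : Tendsto (fun t => ∑ i, E i t) atTop (𝓝 0) := by
      simpa using tendsto_finsetSum Finset.univ fun i _ => hE i
    have := (h1.neg.add (h2.const_mul (2 * ε')))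
    simp only [neg_zero, mul_zero, add_zero] at this
    refine this.congr fun t => by ring
  · have h1 : Tendsto (fun t => K * ∑ i, |E i (t + 1)|) atTop (𝓝 0) := by
      simpa using (tendsto_finsetSum Finset.univ fun i _ =>
        ((hE i).comp (tendsto_add_atTop_nat 1)).abs).const_mul K
    filter_upwards [hasc ε' hε', h1.eventually_lt_const hε'] with t ht1 ht2
    set α : ι → ℝ := fun i => h i (t + 1) - h i t with hα
    have hα0 : ∀ i, 0 ≤ α i := fun i => sub_nonneg.2 (hmono i t.le_succ)
    have hΔE : ∀ i, E i (t + 1) - E i t = α i - α i₀ := fun i => by simp only [E, α]; ring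
    have hS : 0 ≤ ∑ j, α j := Finset.sum_nonneg fun j _ => hα0 j
    have e1 : ∑ i, (gap i (t + 1) - gap i t) * E i (t + 1) ≤ ε' * ∑ j, α j := by
      calc ∑ i, (gap i (t + 1) - gap i t) * E i (t + 1)
          ≤ ∑ i, (K * ∑ j, α j) * |E i (t + 1)| := by
            refine Finset.sum_le_sum fun i _ => (le_abs_self _).trans ?_
            rw [abs_mul]
            exact mul_le_mul_of_nonneg_right (hlip i t) (abs_nonneg _)
        _ = (K * ∑ i, |E i (t + 1)|) * ∑ j, α j := by rw [← Finset.mul_sum]; ring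
        _ ≤ ε' * ∑ j, α j := by gcongr
    have e2 : ∑ i, gap i (t + 1) * E i (t + 1) - ∑ i, gap i t * E i t =
        ∑ i, (gap i (t + 1) - gap i t) * E i (t + 1) +
          (∑ i, α i * gap i t - α i₀ * ∑ i, gap i t) := by
      rw [Finset.mul_sum, ← Finset.sum_sub_distrib, ← Finset.sum_sub_distrib,
        ← Finset.sum_add_distrib]
      refine Finset.sum_congr rfl fun i _ => ?_
      linear_combination gap i t * hΔE i
    have e3 : ∑ i, E i (t + 1) - ∑ i, E i t = ∑ i, α i - Fintype.card ι * α i₀ := by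
      rw [← Finset.sum_sub_distrib, Finset.sum_congr rfl fun i _ => hΔE i]
      simp
    have e4 : ∑ i, α i * (gap i t - ε') = ∑ i, α i * gap i t - ε' * ∑ i, α i := by
      rw [Finset.mul_sum, ← Finset.sum_sub_distrib]
      exact Finset.sum_congr rfl fun i _ => by ring
    change ∑ i, α i * (gap i t - ε') ≤ _ at ht1
    change α i₀ * _ ≤ _
    rw [e4] at ht1
    have e5 : 2 * ε' * (∑ i, E i (t + 1) - ∑ i, E i t) =
        2 * ε' * ∑ i, α i - 2 * ε' * (Fintype.card ι * α i₀) := by rw [e3]; ring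
    linarith

/-- The deterministic core of the convergence proof: a process that climbs a potential `v` with
increments controlled by the gaps `gap i`, each along its own clock `h i`. If the clocks are
asymptotically synchronous and the gaps cannot all vanish near a dense set of levels of `v`, then
the gaps tend to `0`. -/
theorem tendsto_gap_zero (i₀ : ι) {h gap : ι → ℕ → ℝ} {v : ℕ → ℝ} {K B : ℝ}
    (hmono : ∀ i, Monotone (h i))
    (hsync : ∀ i, Tendsto (fun t => h i t - h i₀ t) atTop (𝓝 0))
    (htop : Tendsto (h i₀) atTop atTop)
    (hstep : Tendsto (fun t => h i₀ (t + 1) - h i₀ t) atTop (𝓝 0))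
    (hgap : ∀ i t, 0 ≤ gap i t) (hgapB : ∀ i t, gap i t ≤ B) (hv : ∀ t, |v t| ≤ B)
    (hasc : ∀ ε > 0, ∀ᶠ t in atTop,
      ∑ i, (h i (t + 1) - h i t) * (gap i t - ε) ≤ v (t + 1) - v t)
    (hlip : ∀ i t, |gap i (t + 1) - gap i t| ≤ K * ∑ j, (h j (t + 1) - h j t))
    {s : Set ℝ} (hs : Dense s)
    (hlevel : ∀ c ∈ s, ∃ κ > 0, ∃ δ > 0, ∀ t, |v t - c| ≤ κ → δ ≤ ∑ i, gap i t) (i : ι) :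
    Tendsto (gap i) atTop (𝓝 0) := by
  have hG : ∀ t, 0 ≤ ∑ i, gap i t := fun t => Finset.sum_nonneg fun i _ => hgap i t
  have hw : ∀ ε > 0, ∃ w : ℕ → ℝ, Tendsto (fun t => w t - v t) atTop (𝓝 0) ∧
      ∀ᶠ t in atTop, (h i₀ (t + 1) - h i₀ t) * (∑ i, gap i t - ε) ≤ w (t + 1) - w t :=
    fun ε hε => exists_single_clock_correction i₀ hmono hsync hgap hgapB hasc hlip hε
  obtain ⟨l, hl⟩ := exists_tendsto_of_perturbed_ascent (hmono i₀) hstep hG hw hv hs hlevel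
  have hn : 0 < (Fintype.card ι : ℝ) := by
    have : Nonempty ι := ⟨i₀⟩
    exact_mod_cast Fintype.card_pos
  set N : ℝ := (Fintype.card ι : ℝ)
  have key : Tendsto (fun t => ∑ i, gap i t) atTop (𝓝 0) := by
    refine tendsto_zero_of_perturbed_ascent (K := N * (|K| + 1) * N)
      (Z := fun t => N * (|K| + 1) * ∑ j, (h j t - h i₀ t)) (hmono i₀) htop hG hw hl
      (by positivity) ?_ ?_
    · simpa using (tendsto_finsetSum Finset.univ fun j _ => hsync j).const_mul (N * (|K| + 1))
    · refine monotone_nat_of_le_succ fun t => ?_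
      have hS : 0 ≤ ∑ j, (h j (t + 1) - h j t) :=
        Finset.sum_nonneg fun j _ => sub_nonneg.2 (hmono j t.le_succ)
      have e1 : ∑ i, gap i t - ∑ i, gap i (t + 1) ≤
          N * (|K| + 1) * ∑ j, (h j (t + 1) - h j t) := by
        rw [← Finset.sum_sub_distrib]
        calc ∑ i, (gap i t - gap i (t + 1))
            ≤ ∑ _i : ι, (|K| + 1) * ∑ j, (h j (t + 1) - h j t) := by
              refine Finset.sum_le_sum fun i _ => ?_
              have := (abs_le.1 (hlip i t)).1
              have h2 : K ≤ |K| + 1 := by linarith [le_abs_self K]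
              have := mul_le_mul_of_nonneg_right h2 hS
              linarith
          _ = _ := by simp [N, mul_assoc]
      have e2 : ∑ j, (h j (t + 1) - h j t) = N * (h i₀ (t + 1) - h i₀ t) +
          (∑ j, (h j (t + 1) - h i₀ (t + 1)) - ∑ j, (h j t - h i₀ t)) := by
        simp [Finset.sum_sub_distrib, N]; ring
      rw [e2] at e1
      linarith
  exact squeeze_zero (hgap i)
    (fun t => Finset.single_le_sum (fun j _ => hgap j t) (Finset.mem_univ i)) key

end PerturbedAscent

/-! ### The potential of the game -/

section Potential

variable {n : ℕ} {Y : Type*} [Fintype Y]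

/-- The mixed utility `U_i` as a continuous multilinear map. -/
def Game.utilityMap (Γ : Game n Y) (i : Fin n) :
    ContinuousMultilinearMap ℝ (fun _ : Fin n => Y → ℝ) ℝ :=
  ∑ y : Fin n → Y, Γ.u i y • (ContinuousMultilinearMap.mkPiAlgebra ℝ (Fin n) ℝ
    ).compContinuousLinearMap fun j => ContinuousLinearMap.proj (y j)

theorem Game.utilityMap_apply (Γ : Game n Y) (i : Fin n) (p : Profile n Y) :
    Γ.utilityMap i p = Γ.mixedUtility i p := by
  simp [Game.utilityMap, Game.mixedUtility]

/-- `Γ.replyUtility i m` is the linear map `x ↦ U_i(x, m, …, m)`: the utility of player `i` when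
every opponent uses `m`. -/
def Game.replyUtility (Γ : Game n Y) (i : Fin n) (m : Y → ℝ) : (Y → ℝ) →ₗ[ℝ] ℝ :=
  (Γ.utilityMap i).toMultilinearMap.toLinearMap (fun _ => m) i

theorem Game.replyUtility_apply (Γ : Game n Y) (i : Fin n) (m x : Y → ℝ) :
    Γ.replyUtility i m x = Γ.deviationUtility i x (fun _ => m) :=
  Γ.utilityMap_apply i _

/-- The potential `m ↦ U_i(m, …, m)`. -/
def Game.potential (Γ : Game n Y) (i : Fin n) (m : Y → ℝ) : ℝ := Γ.mixedUtility i fun _ => m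

theorem Game.replyUtility_self (Γ : Game n Y) (i : Fin n) (m : Y → ℝ) :
    Γ.replyUtility i m m = Γ.potential i m := by
  rw [Γ.replyUtility_apply, Game.deviationUtility, Game.potential]
  congr 1
  exact Function.update_eq_self i fun _ => m

theorem Game.replyUtility_eq_sum [DecidableEq Y] (Γ : Game n Y) (i : Fin n) (m x : Y → ℝ) :
    Γ.replyUtility i m x = ∑ y, x y * Γ.replyUtility i m (pureStrategy y) := by
  rw [LinearMap.pi_apply_eq_sum_univ]
  refine Finset.sum_congr rfl fun y _ => ?_
  rw [smul_eq_mul]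
  congr 2
  ext z
  simp [pureStrategy, Pi.single_apply, eq_comm]

theorem Game.mixedUtility_comp_swap {Γ : Game n Y} (h_perm : Γ.PermutationInvariant)
    (k i j : Fin n) (p : Profile n Y) :
    Γ.mixedUtility k (fun l => p (Equiv.swap i j l)) = Γ.mixedUtility k p := by
  unfold Game.mixedUtility
  refine Fintype.sum_equiv (Equiv.arrowCongr (Equiv.swap i j) (Equiv.refl Y)) _ _ fun y => ?_
  have h1 : Equiv.arrowCongr (Equiv.swap i j) (Equiv.refl Y) y = fun l => y (Equiv.swap i j l) := by
    ext l; simp [Equiv.arrowCongr]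
  rw [h1, h_perm k i j y]
  congr 1
  exact Fintype.prod_equiv (Equiv.swap i j) _ _ fun l => by simp

theorem Game.mixedUtility_update_const {Γ : Game n Y} (h_perm : Γ.PermutationInvariant)
    (k i j : Fin n) (m x : Y → ℝ) :
    Γ.mixedUtility k (Function.update (fun _ => m) j x) =
      Γ.mixedUtility k (Function.update (fun _ => m) i x) := by
  rw [← Game.mixedUtility_comp_swap h_perm k i j (Function.update (fun _ => m) j x)]
  congr 1
  ext l : 1
  by_cases hl : l = i
  · subst hl; simp
  · rw [Function.update_of_ne hl, Function.update_of_ne]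
    intro h
    exact hl ((Equiv.swap i j).injective (h.trans (Equiv.swap_apply_left i j).symm))

theorem Game.Identical.mixedUtility_eq {Γ : Game n Y} (h_ident : Γ.Identical) (i j : Fin n)
    (p : Profile n Y) : Γ.mixedUtility i p = Γ.mixedUtility j p := by
  unfold Game.mixedUtility
  exact Finset.sum_congr rfl fun y _ => by rw [h_ident i j]

theorem Game.replyUtility_eq {Γ : Game n Y} (h_ident : Γ.Identical)
    (h_perm : Γ.PermutationInvariant) (i j : Fin n) : Γ.replyUtility i = Γ.replyUtility j := by
  ext1 m
  refine LinearMap.ext fun x => ?_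
  rw [Γ.replyUtility_apply, Γ.replyUtility_apply, Game.deviationUtility, Game.deviationUtility,
    h_ident.mixedUtility_eq i j, Game.mixedUtility_update_const h_perm]

theorem contDiff_mixedUtility (Γ : Game n Y) (i : Fin n) : ContDiff ℝ 1 (Γ.mixedUtility i) := by
  have : Γ.mixedUtility i = Γ.utilityMap i := funext fun p => (Γ.utilityMap_apply i p).symm
  rw [this]
  exact (Γ.utilityMap i).contDiff

theorem contDiff_potential (Γ : Game n Y) (i : Fin n) : ContDiff ℝ 1 (Γ.potential i) :=
  (contDiff_mixedUtility Γ i).comp (contDiff_pi.2 fun _ => contDiff_id)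

theorem contDiff_replyUtility (Γ : Game n Y) (i : Fin n) :
    ContDiff ℝ 1 fun z : (Y → ℝ) × (Y → ℝ) => Γ.replyUtility i z.2 z.1 := by
  simp only [Γ.replyUtility_apply, Game.deviationUtility]
  refine (contDiff_mixedUtility Γ i).comp (contDiff_pi.2 fun j => ?_)
  by_cases hj : j = i
  · subst hj; simpa using contDiff_fst
  · simpa [Function.update_of_ne hj] using contDiff_snd

/-- By symmetry, the derivative of the potential is `n` times the reply utility. -/
theorem fderiv_potential {Γ : Game n Y} (h_perm : Γ.PermutationInvariant)
    (i : Fin n) (m v : Y → ℝ) : fderiv ℝ (Γ.potential i) m v = n * Γ.replyUtility i m v := by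
  let c : (Y → ℝ) →L[ℝ] Profile n Y := ContinuousLinearMap.pi fun _ => ContinuousLinearMap.id ℝ _
  have h1 : HasFDerivAt (Γ.potential i) (((Γ.utilityMap i).linearDeriv (c m)).comp c) m := by
    have := ((Γ.utilityMap i).hasFDerivAt (x := c m)).comp m c.hasFDerivAt
    refine this.congr_of_eventuallyEq (Eventually.of_forall fun x => ?_)
    exact (Γ.utilityMap_apply i _).symm
  rw [h1.fderiv, ContinuousLinearMap.comp_apply, ContinuousMultilinearMap.linearDeriv_apply]
  have h2 : ∀ j : Fin n, Γ.utilityMap i (Function.update (c m) j (c v j)) =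
      Γ.replyUtility i m v := by
    intro j
    rw [Γ.utilityMap_apply, Γ.replyUtility_apply]
    exact Game.mixedUtility_update_const h_perm i i j m v
  rw [Finset.sum_congr rfl fun j _ => h2 j]
  simp

/-- First-order expansion of the potential, uniformly on the simplex. -/
theorem exists_potential_expansion {Γ : Game n Y} (h_perm : Γ.PermutationInvariant) (i : Fin n)
    {ε : ℝ} (hε : 0 < ε) :
    ∃ δ > 0, ∀ m ∈ stdSimplex ℝ Y, ∀ m' ∈ stdSimplex ℝ Y, ‖m' - m‖ < δ →
      |Γ.potential i m' - Γ.potential i m - n * Γ.replyUtility i m (m' - m)| ≤ ε * ‖m' - m‖ := by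
  have hcont : ContinuousOn (fderiv ℝ (Γ.potential i)) (stdSimplex ℝ Y) :=
    ((contDiff_potential Γ i).continuous_fderiv (by simp)).continuousOn
  have hunif := (isCompact_stdSimplex ℝ Y).uniformContinuousOn_of_continuous hcont
  obtain ⟨δ, hδ, H⟩ := Metric.uniformContinuousOn_iff.1 hunif ε hε
  refine ⟨δ, hδ, fun m hm m' hm' hmm => ?_⟩
  rw [← fderiv_potential h_perm]
  have hconv : Convex ℝ (stdSimplex ℝ Y ∩ Metric.ball m δ) :=
    (convex_stdSimplex ℝ Y).inter (convex_ball m δ)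
  refine hconv.norm_image_sub_le_of_norm_fderiv_le' (𝕜 := ℝ)
    (fun x _ => ((contDiff_potential Γ i).differentiable (by simp)).differentiableAt)
    (fun x hx => ?_) ⟨hm, Metric.mem_ball_self hδ⟩ ⟨hm', by rwa [mem_ball_iff_norm]⟩
  rw [← dist_eq_norm]
  exact (H x hx.1 m hm hx.2).le

end Potential

/-! ### Equilibrium values of the potential -/

section CriticalValues

variable {n : ℕ} {Y : Type*} [Fintype Y]

theorem derivation_prod {ι k A : Type*} [DecidableEq ι] [CommRing k] [CommRing A] [Algebra k A]
    (D : Derivation k A A) (s : Finset ι) (f : ι → A) :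
    D (∏ j ∈ s, f j) = ∑ j ∈ s, D (f j) * ∏ l ∈ s.erase j, f l := by
  induction s using Finset.induction_on with
  | empty => simp
  | insert a s ha ih =>
    rw [Finset.prod_insert ha, D.leibniz, ih, Finset.sum_insert ha, Finset.erase_insert ha,
      smul_eq_mul, smul_eq_mul, Finset.mul_sum, add_comm, mul_comm]
    congr 1
    refine Finset.sum_congr rfl fun j hj => ?_
    have hja : a ≠ j := fun h => ha (h ▸ hj)
    rw [Finset.erase_insert_of_ne hja, Finset.prod_insert (by simp [ha])]
    ring

/-- A derivation that kills the utilities acts on the potential by the chain rule. -/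
theorem derivation_potential {Γ : Game n Y} (h_perm : Γ.PermutationInvariant) (i : Fin n)
    {k : Subfield ℝ} (hk : ∀ y, Γ.u i y ∈ k) (D : Derivation k ℝ ℝ) (m : Y → ℝ) :
    D (Γ.potential i m) = n * Γ.replyUtility i m (fun y => D (m y)) := by
  have h1 : ∀ j : Fin n, Γ.mixedUtility i (Function.update (fun _ => m) j (fun y => D (m y))) =
      Γ.replyUtility i m (fun y => D (m y)) := by
    intro j
    rw [Γ.replyUtility_apply]
    exact Game.mixedUtility_update_const h_perm i i j m _
  have h2 : (n : ℝ) * Γ.replyUtility i m (fun y => D (m y)) =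
      ∑ j : Fin n, Γ.mixedUtility i (Function.update (fun _ => m) j (fun y => D (m y))) := by
    rw [Finset.sum_congr rfl fun j _ => h1 j]; simp
  rw [h2]
  simp only [Game.potential, Game.mixedUtility, map_sum]
  rw [Finset.sum_comm]
  refine Finset.sum_congr rfl fun y _ => ?_
  have hu : D (Γ.u i y) = 0 := D.map_algebraMap (⟨_, hk y⟩ : k)
  rw [D.leibniz, hu, smul_zero, add_zero, smul_eq_mul, derivation_prod, Finset.mul_sum]
  refine Finset.sum_congr rfl fun j _ => ?_
  rw [← Finset.mul_prod_erase Finset.univ _ (Finset.mem_univ j), Function.update_self]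
  congr 2
  refine Finset.prod_congr rfl fun l hl => ?_
  rw [Function.update_of_ne (Finset.ne_of_mem_erase hl)]

/-- The potential takes countably many values on symmetric equilibria. At such a strategy `m` all
actions in the support have the same utility `c`, so that a derivation `D` which kills the
utilities satisfies `D (U(m, …, m)) = n c ∑ y, D (m y) = n c D 1 = 0`; hence `U(m, …, m)` is
algebraic over the field generated by the utilities. -/
theorem countable_equilibrium_values [DecidableEq Y] {Γ : Game n Y}
    (h_perm : Γ.PermutationInvariant) (i : Fin n) :
    {c : ℝ | ∃ m ∈ stdSimplex ℝ Y, (∀ y, Γ.replyUtility i m (pureStrategy y) ≤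
      Γ.potential i m) ∧ Γ.potential i m = c}.Countable := by
  obtain ⟨k, hk, hu⟩ := exists_countable_subfield (Set.range (Γ.u i)) (Set.finite_range _)
  refine (countable_of_forall_derivation k).mono ?_
  rintro _ ⟨m, hm, hbest, rfl⟩ D
  rw [derivation_potential h_perm i (fun y => hu ⟨y, rfl⟩)]
  have hslack : ∀ y, m y * (Γ.potential i m - Γ.replyUtility i m (pureStrategy y)) = 0 := by
    have h0 : ∑ y, m y * (Γ.potential i m - Γ.replyUtility i m (pureStrategy y)) = 0 := by
      simp only [mul_sub, Finset.sum_sub_distrib, ← Finset.sum_mul, hm.2]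
      rw [← Γ.replyUtility_eq_sum, Γ.replyUtility_self]
      ring
    have := (Finset.sum_eq_zero_iff_of_nonneg fun y _ =>
      mul_nonneg (hm.1 y) (sub_nonneg.2 (hbest y))).1 h0
    exact fun y => this y (Finset.mem_univ y)
  have hD : ∑ y, D (m y) = 0 := by rw [← map_sum, hm.2, D.map_one_eq_zero]
  have : Γ.replyUtility i m (fun y => D (m y)) = ∑ y, D (m y) * Γ.potential i m := by
    rw [Γ.replyUtility_eq_sum]
    refine Finset.sum_congr rfl fun y _ => ?_
    rcases mul_eq_zero.1 (hslack y) with h | h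
    · simp [h]
    · rw [sub_eq_zero.1 h]
  rw [this, ← Finset.sum_mul, hD]
  simp

end CriticalValues

/-! ### The gap to a best response -/

section Gap

variable {n : ℕ} {Y : Type*}

theorem continuous_centroid : Continuous (centroid : Profile n Y → Y → ℝ) := by
  unfold centroid
  fun_prop

variable [Fintype Y]

theorem centroid_mem_stdSimplex (i : Fin n) {q : Profile n Y} (hq : q ∈ mixedProfiles n Y) :
    centroid q ∈ stdSimplex ℝ Y := by
  have hn : (n : ℝ) ≠ 0 := by exact_mod_cast (Fin.pos i).ne'
  have : centroid q = ∑ j, (1 / (n : ℝ)) • q j := by rw [centroid, Finset.smul_sum]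
  rw [this]
  exact (convex_stdSimplex ℝ Y).sum_mem (fun _ _ => by positivity) (by simp [hn])
    fun j _ => hq j

theorem Game.exists_replyUtility_lipschitz (Γ : Game n Y) (i : Fin n) :
    ∃ K : ℝ, 0 ≤ K ∧ ∀ x ∈ stdSimplex ℝ Y, ∀ m ∈ stdSimplex ℝ Y, ∀ x' ∈ stdSimplex ℝ Y,
      ∀ m' ∈ stdSimplex ℝ Y,
      |Γ.replyUtility i m' x' - Γ.replyUtility i m x| ≤ K * (‖x' - x‖ + ‖m' - m‖) := by
  obtain ⟨K, hK⟩ := ((contDiff_replyUtility Γ i).locallyLipschitz.locallyLipschitzOn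
    ).exists_lipschitzOnWith_of_compact
      ((isCompact_stdSimplex ℝ Y).prod (isCompact_stdSimplex ℝ Y))
  refine ⟨K, K.2, fun x hx m hm x' hx' m' hm' => ?_⟩
  have := hK.dist_le_mul (x', m') ⟨hx', hm'⟩ (x, m) ⟨hx, hm⟩
  rw [Real.dist_eq] at this
  refine this.trans (mul_le_mul_of_nonneg_left ?_ K.2)
  rw [dist_eq_norm, Prod.norm_def]
  exact max_le_add_of_nonneg (norm_nonneg _) (norm_nonneg _)

theorem isCompact_mixedProfiles : IsCompact (mixedProfiles n Y) := by
  have : mixedProfiles n Y = Set.univ.pi fun _ => stdSimplex ℝ Y := by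
    ext p; simp [mixedProfiles]
  rw [this]
  exact isCompact_univ_pi fun _ => isCompact_stdSimplex ℝ Y

theorem norm_sub_le_one_of_mem_stdSimplex {x y : Y → ℝ} (hx : x ∈ stdSimplex ℝ Y)
    (hy : y ∈ stdSimplex ℝ Y) : ‖x - y‖ ≤ 1 := by
  refine (pi_norm_le_iff_of_nonneg zero_le_one).2 fun z => ?_
  have h1 : ∀ {w : Y → ℝ}, w ∈ stdSimplex ℝ Y → w z ≤ 1 := fun hw =>
    hw.2 ▸ Finset.single_le_sum (fun j _ => hw.1 j) (Finset.mem_univ z)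
  rw [Pi.sub_apply, Real.norm_eq_abs, abs_le]
  constructor <;> linarith [h1 hx, h1 hy, hx.1 z, hy.1 z]

theorem norm_centroid_sub_le (i : Fin n) {q q' : Profile n Y} {α : Fin n → ℝ} (hα : ∀ j, 0 ≤ α j)
    (hq' : ∀ j, ‖q' j - q j‖ ≤ α j) : ‖centroid q' - centroid q‖ ≤ ∑ j, α j := by
  have hn : (1 : ℝ) ≤ n := by exact_mod_cast Fin.pos i
  have h0 : 0 ≤ ∑ j, α j := Finset.sum_nonneg fun j _ => hα j
  rw [centroid, centroid, ← smul_sub, ← Finset.sum_sub_distrib, norm_smul,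
    Real.norm_of_nonneg (by positivity)]
  calc 1 / (n : ℝ) * ‖∑ j, (q' j - q j)‖ ≤ 1 * ∑ j, α j := by
        refine mul_le_mul ?_ (norm_sum_le_of_le _ fun j _ => hq' j) (norm_nonneg _) zero_le_one
        exact (div_le_one (by positivity)).2 hn
    _ = _ := one_mul _

variable [DecidableEq Y]

theorem pureStrategy_mem_stdSimplex (y : Y) : pureStrategy y ∈ stdSimplex ℝ Y :=
  single_mem_stdSimplex ℝ y

/-- `Γ.gap i x m` is the amount by which `x` fails to be a best response of player `i` when every
opponent uses `m`. -/
def Game.gap (Γ : Game n Y) (i : Fin n) (x m : Y → ℝ) : ℝ :=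
  (⨆ y, Γ.replyUtility i m (pureStrategy y)) - Γ.replyUtility i m x

theorem Game.pure_le_iSup (Γ : Game n Y) (i : Fin n) (m : Y → ℝ) (y : Y) :
    Γ.replyUtility i m (pureStrategy y) ≤ ⨆ y, Γ.replyUtility i m (pureStrategy y) :=
  le_ciSup (f := fun y => Γ.replyUtility i m (pureStrategy y)) (Set.finite_range _).bddAbove y

theorem Game.replyUtility_le_iSup (Γ : Game n Y) (i : Fin n) (m : Y → ℝ) {x : Y → ℝ}
    (hx : x ∈ stdSimplex ℝ Y) :
    Γ.replyUtility i m x ≤ ⨆ y, Γ.replyUtility i m (pureStrategy y) := by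
  rw [Γ.replyUtility_eq_sum]
  calc ∑ y, x y * Γ.replyUtility i m (pureStrategy y)
      ≤ ∑ y, x y * ⨆ y, Γ.replyUtility i m (pureStrategy y) :=
        Finset.sum_le_sum fun y _ => mul_le_mul_of_nonneg_left (Γ.pure_le_iSup i m y) (hx.1 y)
    _ = _ := by rw [← Finset.sum_mul, hx.2, one_mul]

theorem Game.gap_nonneg (Γ : Game n Y) (i : Fin n) (m : Y → ℝ) {x : Y → ℝ}
    (hx : x ∈ stdSimplex ℝ Y) : 0 ≤ Γ.gap i x m :=
  sub_nonneg.2 (Γ.replyUtility_le_iSup i m hx)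

theorem Game.gap_eq {Γ : Game n Y} (h_ident : Γ.Identical) (h_perm : Γ.PermutationInvariant)
    (i j : Fin n) : Γ.gap i = Γ.gap j := by
  unfold Game.gap
  rw [Game.replyUtility_eq h_ident h_perm i j]

/-- Since utilities are linear in the own strategy, the gap of the centroid is the mean gap. -/
theorem Game.sum_gap (Γ : Game n Y) (i : Fin n) (q : Profile n Y) (m : Y → ℝ) :
    ∑ j, Γ.gap i (q j) m = n * Γ.gap i (centroid q) m := by
  have hn : (n : ℝ) ≠ 0 := by exact_mod_cast (Fin.pos i).ne'
  simp only [Game.gap, centroid, Finset.sum_sub_distrib, map_smul, map_sum, smul_eq_mul]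
  simp only [Finset.sum_const, Finset.card_univ, Fintype.card_fin, nsmul_eq_mul]
  field_simp

theorem Game.le_of_gap_eq_zero {Γ : Game n Y} {i : Fin n} {m x : Y → ℝ} (h : Γ.gap i x m = 0)
    {x' : Y → ℝ} (hx' : x' ∈ stdSimplex ℝ Y) :
    Γ.deviationUtility i x' (fun _ => m) ≤ Γ.deviationUtility i x (fun _ => m) := by
  rw [← Γ.replyUtility_apply, ← Γ.replyUtility_apply, ← sub_eq_zero.1 h]
  exact Γ.replyUtility_le_iSup i m hx'

theorem Game.iSup_sub_le_of_mem_bestResponse [Nonempty Y] {Γ : Game n Y} {ε : ℝ} {i : Fin n}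
    {m : Y → ℝ} {y : Y} (hy : y ∈ Γ.bestResponse ε i fun _ => m) :
    (⨆ y, Γ.replyUtility i m (pureStrategy y)) - ε ≤ Γ.replyUtility i m (pureStrategy y) := by
  have : (⨆ y, Γ.replyUtility i m (pureStrategy y)) ≤
      Γ.replyUtility i m (pureStrategy y) + ε := by
    refine ciSup_le fun y' => ?_
    have := hy y'
    rw [← Γ.replyUtility_apply, ← Γ.replyUtility_apply] at this
    linarith
  linarith

theorem Game.exists_gap_lipschitz [Nonempty Y] (Γ : Game n Y) (i : Fin n) :
    ∃ K : ℝ, 0 ≤ K ∧ ∀ x ∈ stdSimplex ℝ Y, ∀ m ∈ stdSimplex ℝ Y, ∀ x' ∈ stdSimplex ℝ Y,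
      ∀ m' ∈ stdSimplex ℝ Y, |Γ.gap i x' m' - Γ.gap i x m| ≤ K * (‖x' - x‖ + ‖m' - m‖) := by
  obtain ⟨K, hK0, hK⟩ := Γ.exists_replyUtility_lipschitz i
  have hsup : ∀ m ∈ stdSimplex ℝ Y, ∀ m' ∈ stdSimplex ℝ Y,
      (⨆ y, Γ.replyUtility i m' (pureStrategy y)) ≤
        (⨆ y, Γ.replyUtility i m (pureStrategy y)) + K * ‖m' - m‖ := by
    intro m hm m' hm'
    refine ciSup_le fun y => ?_
    have := hK _ (pureStrategy_mem_stdSimplex y) m hm _ (pureStrategy_mem_stdSimplex y) m' hm'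
    rw [sub_self, norm_zero, zero_add] at this
    linarith [(abs_le.1 this).2, Γ.pure_le_iSup i m y]
  refine ⟨2 * K, by positivity, fun x hx m hm x' hx' m' hm' => ?_⟩
  have h1 := hsup m hm m' hm'
  have h2 := hsup m' hm' m hm
  rw [norm_sub_rev] at h2
  have h3 := abs_le.1 (hK x hx m hm x' hx' m' hm')
  have h4 := mul_nonneg hK0 (norm_nonneg (x' - x))
  unfold Game.gap
  rw [abs_le]
  constructor <;> nlinarith

theorem Game.continuousOn_gap [Nonempty Y] (Γ : Game n Y) (i : Fin n) :
    ContinuousOn (fun z : (Y → ℝ) × (Y → ℝ) => Γ.gap i z.1 z.2)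
      (stdSimplex ℝ Y ×ˢ stdSimplex ℝ Y) := by
  obtain ⟨K, hK0, hK⟩ := Γ.exists_gap_lipschitz i
  refine (LipschitzOnWith.of_dist_le_mul (K := Real.toNNReal (2 * K)) ?_).continuousOn
  rintro ⟨x', m'⟩ ⟨hx', hm'⟩ ⟨x, m⟩ ⟨hx, hm⟩
  rw [Real.dist_eq, Real.coe_toNNReal _ (by positivity), dist_eq_norm, Prod.norm_def]
  refine (hK x hx m hm x' hx' m' hm').trans ?_
  have h1 := le_max_left ‖x' - x‖ ‖m' - m‖
  have h2 := le_max_right ‖x' - x‖ ‖m' - m‖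
  change K * (‖x' - x‖ + ‖m' - m‖) ≤ 2 * K * max ‖x' - x‖ ‖m' - m‖
  nlinarith

theorem Game.continuousOn_gap_centroid [Nonempty Y] (Γ : Game n Y) (i j : Fin n) :
    ContinuousOn (fun q : Profile n Y => Γ.gap i (q j) (centroid q)) (mixedProfiles n Y) :=
  (Γ.continuousOn_gap i).comp (f := fun q : Profile n Y => (q j, centroid q))
    ((continuous_apply j).prodMk continuous_centroid).continuousOn
    fun _ hq => ⟨hq j, centroid_mem_stdSimplex i hq⟩

/-- Away from the countably many equilibrium values of the potential, the gaps cannot all be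
small. -/
theorem Game.exists_dense_levels [Nonempty Y] {Γ : Game n Y}
    (h_perm : Γ.PermutationInvariant) (i : Fin n) :
    ∃ s : Set ℝ, Dense s ∧ ∀ c ∈ s, ∃ κ > 0, ∃ δ > 0, ∀ q ∈ mixedProfiles n Y,
      |Γ.potential i (centroid q) - c| ≤ κ → δ ≤ ∑ j, Γ.gap i (q j) (centroid q) := by
  refine ⟨_, (countable_equilibrium_values h_perm i).dense_compl ℝ, fun c hc => ?_⟩
  have hdiag : ContinuousOn (fun m => Γ.gap i m m) (stdSimplex ℝ Y) :=
    (Γ.continuousOn_gap i).comp (f := fun m => (m, m))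
      (continuous_id.prodMk continuous_id).continuousOn fun _ hm => ⟨hm, hm⟩
  have habs : ContinuousOn (fun m => |Γ.potential i m - c|) (stdSimplex ℝ Y) :=
    ((contDiff_potential Γ i).continuous.sub continuous_const).abs.continuousOn
  have hcont : ContinuousOn (fun m => Γ.gap i m m + |Γ.potential i m - c|) (stdSimplex ℝ Y) :=
    hdiag.add habs
  obtain ⟨m₀, hm₀, hmin⟩ := (isCompact_stdSimplex ℝ Y).exists_isMinOn
    ⟨pureStrategy (Classical.arbitrary Y), pureStrategy_mem_stdSimplex _⟩ hcont
  set β := Γ.gap i m₀ m₀ + |Γ.potential i m₀ - c| with hβ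
  have hβ0 : 0 < β := by
    have h1 := Γ.gap_nonneg i m₀ hm₀
    have h2 := abs_nonneg (Γ.potential i m₀ - c)
    refine lt_of_le_of_ne (by positivity) fun h => hc ⟨m₀, hm₀, fun y => ?_, ?_⟩
    · have h3 : Γ.gap i m₀ m₀ = 0 := by linarith
      have := Game.le_of_gap_eq_zero h3 (pureStrategy_mem_stdSimplex y)
      rwa [← Γ.replyUtility_apply, ← Γ.replyUtility_apply, Γ.replyUtility_self] at this
    · have h3 : |Γ.potential i m₀ - c| = 0 := by linarith
      exact sub_eq_zero.1 (abs_eq_zero.1 h3)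
  refine ⟨β / 2, by positivity, β / 2, by positivity, fun q hq hqc => ?_⟩
  have h1 : β ≤ Γ.gap i (centroid q) (centroid q) + |Γ.potential i (centroid q) - c| :=
    hmin (centroid_mem_stdSimplex i hq)
  have h2 := Γ.gap_nonneg i (centroid q) (centroid_mem_stdSimplex i hq)
  rw [Γ.sum_gap]
  have hn : (1 : ℝ) ≤ n := by exact_mod_cast Fin.pos i
  have h3 := le_mul_of_one_le_left h2 hn
  linarith

/-- If every player `j` moves from `q j` a small fraction `α j` of the way towards an almost best
response to the centroid, then the potential of the centroid increases by at least
`∑ j, α j * gap j`, up to a small multiple of `∑ j, α j`. -/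
theorem Game.exists_potential_ascent [Nonempty Y] {Γ : Game n Y} (h_ident : Γ.Identical)
    (h_perm : Γ.PermutationInvariant) (i : Fin n) {ε : ℝ} (hε : 0 < ε) :
    ∃ δ > 0, ∀ q ∈ mixedProfiles n Y, ∀ q' ∈ mixedProfiles n Y, ∀ (α : Fin n → ℝ)
      (b : Fin n → Y) (η : ℝ), (∀ j, 0 ≤ α j) → ∑ j, α j < δ → η < δ →
      (∀ j, q' j = q j + α j • (pureStrategy (b j) - q j)) →
      (∀ j, b j ∈ Γ.bestResponse η j fun _ => centroid q) →
      ∑ j, α j * (Γ.gap i (q j) (centroid q) - ε) ≤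
        Γ.potential i (centroid q') - Γ.potential i (centroid q) := by
  obtain ⟨δ, hδ, H⟩ := exists_potential_expansion h_perm i (half_pos hε)
  refine ⟨min δ (ε / 2), lt_min hδ (half_pos hε), ?_⟩
  intro q hq q' hq' α b η hα hαδ hη hstep hbest
  have hn : (n : ℝ) ≠ 0 := by exact_mod_cast (Fin.pos i).ne'
  have hmove : ‖centroid q' - centroid q‖ ≤ ∑ j, α j := by
    refine norm_centroid_sub_le i hα fun j => ?_
    rw [hstep, add_sub_cancel_left, norm_smul, Real.norm_of_nonneg (hα j)]
    exact mul_le_of_le_one_right (hα j)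
      (norm_sub_le_one_of_mem_stdSimplex (pureStrategy_mem_stdSimplex _) (hq j))
  have h1 := H _ (centroid_mem_stdSimplex i hq) _ (centroid_mem_stdSimplex i hq')
    (hmove.trans_lt (hαδ.trans_le (min_le_left _ _)))
  have h2 : n * Γ.replyUtility i (centroid q) (centroid q' - centroid q) =
      ∑ j, α j * (Γ.replyUtility i (centroid q) (pureStrategy (b j)) -
        Γ.replyUtility i (centroid q) (q j)) := by
    have : centroid q' - centroid q =
        (1 / (n : ℝ)) • ∑ j, α j • (pureStrategy (b j) - q j) := by
      rw [centroid, centroid, ← smul_sub, ← Finset.sum_sub_distrib]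
      congr 1
      exact Finset.sum_congr rfl fun j _ => by rw [hstep]; abel
    rw [this]
    simp only [map_smul, map_sum, map_sub, smul_eq_mul]
    field_simp
  have h3 : ∑ j, α j * (Γ.gap i (q j) (centroid q) - ε / 2) ≤
      ∑ j, α j * (Γ.replyUtility i (centroid q) (pureStrategy (b j)) -
        Γ.replyUtility i (centroid q) (q j)) := by
    refine Finset.sum_le_sum fun j _ => mul_le_mul_of_nonneg_left ?_ (hα j)
    have := Game.iSup_sub_le_of_mem_bestResponse (hbest j)
    rw [Game.replyUtility_eq h_ident h_perm j i] at this
    unfold Game.gap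
    linarith [min_le_right δ (ε / 2)]
  have h4 : ∑ j, α j * (Γ.gap i (q j) (centroid q) - ε) =
      ∑ j, α j * (Γ.gap i (q j) (centroid q) - ε / 2) - ε / 2 * ∑ j, α j := by
    rw [Finset.mul_sum, ← Finset.sum_sub_distrib]
    exact Finset.sum_congr rfl fun j _ => by ring
  have h5 := mul_le_mul_of_nonneg_left hmove (half_pos hε).le
  linarith [(abs_le.1 h1).1]

end Gap

/-! ### A strong law for conditional probabilities -/

section StrongLaw

/-- **Kronecker's lemma**, for weights `1 + ∑ k < t, ρ k` that diverge. -/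
theorem tendsto_sum_div_of_tendsto_sum_div {d ρ : ℕ → ℝ} (hρ : ∀ k, 0 ≤ ρ k)
    (htop : Tendsto (fun t => ∑ k ∈ Finset.range t, ρ k) atTop atTop) {l : ℝ}
    (hl : Tendsto (fun t => ∑ k ∈ Finset.range t,
      d k / (1 + ∑ j ∈ Finset.range (k + 1), ρ j)) atTop (𝓝 l)) :
    Tendsto (fun t => (∑ k ∈ Finset.range t, d k) / ∑ k ∈ Finset.range t, ρ k) atTop (𝓝 0) := by
  set M : ℕ → ℝ := fun t => ∑ k ∈ Finset.range t, d k / (1 + ∑ j ∈ Finset.range (k + 1), ρ j)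
    with hM
  set R : ℕ → ℝ := fun t => ∑ k ∈ Finset.range t, ρ k with hR
  have hR0 : ∀ t, 0 ≤ R t := fun t => Finset.sum_nonneg fun k _ => hρ k
  -- Summation by parts.
  have hparts : ∀ t, ∑ k ∈ Finset.range t, d k =
      (1 + R t) * (M t - l) + l - ∑ k ∈ Finset.range t, ρ k * (M k - l) := by
    intro t
    induction t with
    | zero => simp [hM, hR]
    | succ t ih =>
      have h1 : M (t + 1) = M t + d t / (1 + R (t + 1)) := Finset.sum_range_succ _ _
      have h2 : R (t + 1) = R t + ρ t := Finset.sum_range_succ _ _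
      have h3 : 1 + R (t + 1) ≠ 0 := by linarith [hR0 (t + 1)]
      have h4 : (1 + R (t + 1)) * M (t + 1) = (1 + R (t + 1)) * M t + d t := by
        rw [h1, mul_add, mul_div_cancel₀ _ h3]
      rw [Finset.sum_range_succ, Finset.sum_range_succ, ih]
      linear_combination (l - M t) * h2 - h4
  have hMl : Tendsto (fun t => M t - l) atTop (𝓝 0) := tendsto_sub_nhds_zero_iff.2 hl
  have h1 : (fun t => ∑ k ∈ Finset.range t, ρ k * (M k - l)) =o[atTop] R := by
    refine Asymptotics.IsLittleO.sum_range (g := ρ) ?_ hρ htop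
    have := (Asymptotics.isLittleO_one_iff ℝ).2 hMl
    simpa using (Asymptotics.isBigO_refl ρ atTop).mul_isLittleO this
  have h2 : Tendsto (fun t => (1 + R t) / R t) atTop (𝓝 1) := by
    have : Tendsto (fun t => (R t)⁻¹ + 1) atTop (𝓝 (0 + 1)) :=
      (tendsto_inv_atTop_zero.comp htop).add_const 1
    rw [zero_add] at this
    refine this.congr' ?_
    filter_upwards [htop.eventually_gt_atTop 0] with t ht
    have : R t ≠ 0 := ne_of_gt ht
    field_simp
  have h3 := ((h2.mul hMl).add (htop.const_div_atTop l)).sub h1.tendsto_div_nhds_zero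
  simp only [mul_zero, add_zero, sub_zero] at h3
  refine h3.congr fun t => ?_
  rw [hparts t]
  ring

variable {Ω : Type*} {m0 : MeasurableSpace Ω} {μ : Measure Ω} [IsProbabilityMeasure μ]
  {ℱ : Filtration ℕ m0} {x r : ℕ → Ω → ℝ}

theorem condExp_mul_sub_eq_zero {t : ℕ} (hx : Integrable (x t) μ)
    (hr : Integrable (r t) μ) (hrm : StronglyMeasurable[ℱ t] (r t))
    (hxr : μ[x t|ℱ t] =ᵐ[μ] r t) {g : Ω → ℝ} (hg : StronglyMeasurable[ℱ t] g) {C : ℝ}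
    (hgC : ∀ ω, |g ω| ≤ C) : μ[g * (x t - r t)|ℱ t] =ᵐ[μ] 0 := by
  have hint : Integrable (g * (x t - r t)) μ :=
    (hx.sub hr).bdd_mul (hg.mono (ℱ.le t)).aestronglyMeasurable
      (Eventually.of_forall fun ω => by simpa using hgC ω)
  have h1 := condExp_mul_of_stronglyMeasurable_left hg hint (hx.sub hr)
  have h2 := condExp_sub hx hr (ℱ t)
  have h3 := condExp_of_stronglyMeasurable (ℱ.le t) hrm hr
  filter_upwards [h1, h2, hxr] with ω e1 e2 e3
  rw [e1, Pi.mul_apply, e2, Pi.sub_apply, e3, h3]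
  simp

theorem integral_mul_sub_eq_zero {t : ℕ} (hx : Integrable (x t) μ)
    (hr : Integrable (r t) μ) (hrm : StronglyMeasurable[ℱ t] (r t))
    (hxr : μ[x t|ℱ t] =ᵐ[μ] r t) {g : Ω → ℝ} (hg : StronglyMeasurable[ℱ t] g) {C : ℝ}
    (hgC : ∀ ω, |g ω| ≤ C) : ∫ ω, g ω * (x t ω - r t ω) ∂μ = 0 := by
  have h1 := integral_condExp (μ := μ) (f := g * (x t - r t)) (ℱ.le t)
  rw [integral_congr_ae (condExp_mul_sub_eq_zero hx hr hrm hxr hg hgC)] at h1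
  simpa using h1.symm

/-- The martingale `∑ k < t, (x k - r k) / (1 + ∑ j ≤ k, r j)` is bounded in `L²` since
`r k / (1 + ∑ j ≤ k, r j)²` is dominated by a telescoping sum; hence it converges. -/
theorem ae_exists_tendsto_sum_div (hx : ∀ t, StronglyMeasurable[ℱ (t + 1)] (x t))
    (hx0 : ∀ t ω, 0 ≤ x t ω) (hx1 : ∀ t ω, x t ω ≤ 1)
    (hr : ∀ t, StronglyMeasurable[ℱ t] (r t)) (hr0 : ∀ t ω, 0 ≤ r t ω) (hr1 : ∀ t ω, r t ω ≤ 1)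
    (hxr : ∀ t, μ[x t|ℱ t] =ᵐ[μ] r t) :
    ∀ᵐ ω ∂μ, ∃ l, Tendsto (fun t => ∑ k ∈ Finset.range t,
      (x k ω - r k ω) / (1 + ∑ j ∈ Finset.range (k + 1), r j ω)) atTop (𝓝 l) := by
  have hxi : ∀ t, Integrable (x t) μ := fun t =>
    Integrable.of_bound ((hx t).mono (ℱ.le _)).aestronglyMeasurable 1
      (Eventually.of_forall fun ω => by rw [Real.norm_of_nonneg (hx0 t ω)]; exact hx1 t ω)
  have hri : ∀ t, Integrable (r t) μ := fun t =>
    Integrable.of_bound ((hr t).mono (ℱ.le _)).aestronglyMeasurable 1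
      (Eventually.of_forall fun ω => by rw [Real.norm_of_nonneg (hr0 t ω)]; exact hr1 t ω)
  let R : ℕ → Ω → ℝ := fun t ω => 1 + ∑ j ∈ Finset.range t, r j ω
  have hR1 : ∀ t ω, 1 ≤ R t ω := fun t ω =>
    le_add_of_nonneg_right (Finset.sum_nonneg fun j _ => hr0 j ω)
  have hRsucc : ∀ t ω, R (t + 1) ω = R t ω + r t ω := fun t ω => by
    simp only [R, Finset.sum_range_succ]; ring
  have hRm : ∀ t, StronglyMeasurable[ℱ t] (R (t + 1)) := fun t =>
    stronglyMeasurable_const.add (Finset.stronglyMeasurable_fun_sum _ fun j hj =>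
      (hr j).mono (ℱ.mono (Nat.lt_succ_iff.1 (Finset.mem_range.1 hj))))
  let G : ℕ → Ω → ℝ := fun t ω => (R (t + 1) ω)⁻¹
  have hGm : ∀ t, StronglyMeasurable[ℱ t] (G t) := fun t => (hRm t).inv₀
  have hG0 : ∀ t ω, 0 ≤ G t ω := fun t ω => inv_nonneg.2 (zero_le_one.trans (hR1 _ _))
  have hG1 : ∀ t ω, G t ω ≤ 1 := fun t ω => inv_le_one_of_one_le₀ (hR1 _ _)
  let M : ℕ → Ω → ℝ := fun t ω => ∑ k ∈ Finset.range t, G k ω * (x k ω - r k ω)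
  have hMm : ∀ t, StronglyMeasurable[ℱ t] (M t) := fun t =>
    Finset.stronglyMeasurable_fun_sum _ fun k hk => by
      have hk := Finset.mem_range.1 hk
      exact ((hGm k).mono (ℱ.mono hk.le)).mul
        (((hx k).mono (ℱ.mono hk)).sub ((hr k).mono (ℱ.mono hk.le)))
  have hd : ∀ t ω, |G t ω * (x t ω - r t ω)| ≤ 1 := fun t ω => by
    rw [abs_mul, abs_of_nonneg (hG0 t ω)]
    refine mul_le_one₀ (hG1 t ω) (abs_nonneg _) (abs_le.2 ⟨?_, ?_⟩) <;>
    linarith [hx0 t ω, hx1 t ω, hr0 t ω, hr1 t ω]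
  have hMC : ∀ t ω, |M t ω| ≤ t := fun t ω =>
    (Finset.abs_sum_le_sum_abs _ _).trans
      ((Finset.sum_le_sum fun k _ => hd k ω).trans (by simp))
  have hMi : ∀ t, Integrable (M t) μ := fun t =>
    Integrable.of_bound ((hMm t).mono (ℱ.le _)).aestronglyMeasurable t
      (Eventually.of_forall fun ω => hMC t ω)
  have hMsucc : ∀ t ω, M (t + 1) ω = M t ω + G t ω * (x t ω - r t ω) := fun t ω =>
    Finset.sum_range_succ _ _
  have hmart : Martingale M ℱ μ := by
    refine martingale_of_condExp_sub_eq_zero_nat hMm hMi fun t => ?_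
    have : M (t + 1) - M t = G t * (x t - r t) := by
      ext ω
      simp [hMsucc t ω]
    rw [this]
    exact condExp_mul_sub_eq_zero (hxi t) (hri t) (hr t) (hxr t) (hGm t) (C := 1) fun ω => by
      rw [abs_of_nonneg (hG0 t ω)]; exact hG1 t ω
  have hbd : ∀ {f : Ω → ℝ} {t : ℕ} (C : ℝ), StronglyMeasurable[ℱ t] f → (∀ ω, |f ω| ≤ C) →
      Integrable f μ := fun {f t} C hf hC =>
    Integrable.of_bound (hf.mono (ℱ.le t)).aestronglyMeasurable C
      (Eventually.of_forall fun ω => hC ω)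
  have hRinv : ∀ t, Integrable (fun ω => (R t ω)⁻¹) μ := fun t =>
    hbd (t := t) 1 (by
      refine StronglyMeasurable.inv₀ ?_
      exact stronglyMeasurable_const.add (Finset.stronglyMeasurable_fun_sum _ fun j hj =>
        (hr j).mono (ℱ.mono (Finset.mem_range.1 hj).le))) fun ω => by
      rw [abs_of_nonneg (inv_nonneg.2 (zero_le_one.trans (hR1 _ _)))]
      exact inv_le_one_of_one_le₀ (hR1 _ _)
  have hM2i : ∀ t, Integrable (fun ω => M t ω ^ 2) μ := fun t =>
    hbd (t := t) ((t : ℝ) ^ 2) ((hMm t).pow 2) fun ω => by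
      rw [abs_pow]
      exact pow_le_pow_left₀ (abs_nonneg _) (hMC t ω) 2
  have hL2 : ∀ t, ∫ ω, M t ω ^ 2 ∂μ ≤ ∫ ω, (1 - (R t ω)⁻¹) ∂μ := by
    intro t
    induction t with
    | zero => simp [M, R]
    | succ t ih =>
      -- The coefficient of the martingale difference in the expansion of the square.
      let c : Ω → ℝ := fun ω => 2 * M t ω * G t ω + G t ω ^ 2 * (1 - 2 * r t ω)
      have hcm : StronglyMeasurable[ℱ t] c :=
        ((stronglyMeasurable_const.mul (hMm t)).mul (hGm t)).add
          (((hGm t).pow 2).mul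
            (stronglyMeasurable_const.sub (stronglyMeasurable_const.mul (hr t))))
      have hcC : ∀ ω, |c ω| ≤ 2 * t + 1 := by
        intro ω
        refine (abs_add_le _ _).trans (add_le_add ?_ ?_)
        · rw [abs_mul, abs_mul, abs_of_nonneg (hG0 t ω), abs_two]
          have := hMC t ω
          have h1 := mul_le_mul this (hG1 t ω) (hG0 t ω) (Nat.cast_nonneg t)
          linarith
        · rw [abs_mul, abs_of_nonneg (sq_nonneg _)]
          refine mul_le_one₀ (pow_le_one₀ (hG0 t ω) (hG1 t ω)) (abs_nonneg _) (abs_le.2 ⟨?_, ?_⟩)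
            <;> linarith [hr0 t ω, hr1 t ω]
      have hzero := integral_mul_sub_eq_zero (hxi t) (hri t) (hr t) (hxr t) hcm hcC
      have hci : Integrable (fun ω => c ω * (x t ω - r t ω)) μ :=
        ((hxi t).sub (hri t)).bdd_mul (hcm.mono (ℱ.le t)).aestronglyMeasurable
          (Eventually.of_forall hcC)
      have hpt : ∀ ω, M (t + 1) ω ^ 2 ≤
          (M t ω ^ 2 + c ω * (x t ω - r t ω)) + ((R t ω)⁻¹ - (R (t + 1) ω)⁻¹) := by
        intro ω
        have h1 : G t ω ^ 2 * r t ω ≤ (R t ω)⁻¹ - (R (t + 1) ω)⁻¹ := by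
          have hp := zero_lt_one.trans_le (hR1 t ω)
          have hq := zero_lt_one.trans_le (hR1 (t + 1) ω)
          have : (R t ω)⁻¹ - (R (t + 1) ω)⁻¹ = (R t ω)⁻¹ * G t ω * r t ω := by
            simp only [G]
            rw [inv_sub_inv hp.ne' hq.ne', hRsucc]
            field_simp
            ring
          rw [this, sq]
          refine mul_le_mul_of_nonneg_right (mul_le_mul_of_nonneg_right ?_ (hG0 t ω)) (hr0 t ω)
          exact inv_anti₀ hp (by rw [hRsucc]; linarith [hr0 t ω])
        have h2 : x t ω ^ 2 ≤ x t ω := by nlinarith [hx0 t ω, hx1 t ω]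
        have h3 := mul_le_mul_of_nonneg_left h2 (sq_nonneg (G t ω))
        have h4 : 0 ≤ G t ω ^ 2 * r t ω ^ 2 := by positivity
        rw [hMsucc]
        simp only [c]
        nlinarith
      calc ∫ ω, M (t + 1) ω ^ 2 ∂μ
          ≤ ∫ ω, ((M t ω ^ 2 + c ω * (x t ω - r t ω)) + ((R t ω)⁻¹ - (R (t + 1) ω)⁻¹)) ∂μ :=
            integral_mono (hM2i _) (((hM2i t).add hci).add ((hRinv t).sub (hRinv (t + 1)))) hpt
        _ = ∫ ω, M t ω ^ 2 ∂μ + (∫ ω, (R t ω)⁻¹ ∂μ - ∫ ω, (R (t + 1) ω)⁻¹ ∂μ) := by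
            have e1 : Integrable (fun ω => M t ω ^ 2 + c ω * (x t ω - r t ω)) μ :=
              (hM2i t).add hci
            have e2 : Integrable (fun ω => (R t ω)⁻¹ - (R (t + 1) ω)⁻¹) μ :=
              (hRinv t).sub (hRinv (t + 1))
            rw [integral_add e1 e2, integral_add (hM2i t) hci, hzero,
              integral_sub (hRinv t) (hRinv (t + 1)), add_zero]
        _ ≤ ∫ ω, (1 - (R (t + 1) ω)⁻¹) ∂μ := by
            rw [integral_sub (integrable_const _) (hRinv _)] at ih ⊢
            linarith
  have hL1 : ∀ t, eLpNorm (M t) 1 μ ≤ (1 : NNReal) := by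
    intro t
    rw [eLpNorm_one_eq_lintegral_enorm, ← ofReal_integral_norm_eq_lintegral_enorm (hMi t)]
    have h1 : ∫ ω, M t ω ^ 2 ∂μ ≤ 1 := by
      refine (hL2 t).trans ?_
      calc ∫ ω, (1 - (R t ω)⁻¹) ∂μ ≤ ∫ _, (1 : ℝ) ∂μ :=
            integral_mono ((integrable_const _).sub (hRinv t)) (integrable_const _) fun ω =>
              sub_le_self _ (inv_nonneg.2 (zero_le_one.trans (hR1 _ _)))
        _ = 1 := by simp
    have h2 : ∫ ω, ‖M t ω‖ ∂μ ≤ 1 := by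
      calc ∫ ω, ‖M t ω‖ ∂μ ≤ ∫ ω, (1 / 2 + 1 / 2 * M t ω ^ 2) ∂μ := by
            refine integral_mono (hMi t).norm
              ((integrable_const _).add ((hM2i t).const_mul _)) fun ω => ?_
            simp only [Real.norm_eq_abs]
            nlinarith [sq_nonneg (|M t ω| - 1), sq_abs (M t ω)]
        _ = 1 / 2 + 1 / 2 * ∫ ω, M t ω ^ 2 ∂μ := by
            rw [integral_add (integrable_const _) ((hM2i t).const_mul _), integral_const_mul]
            simp
        _ ≤ 1 := by linarith
    simpa using h2
  filter_upwards [hmart.submartingale.exists_ae_tendsto_of_bdd hL1] with ω hω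
  obtain ⟨l, hl⟩ := hω
  refine ⟨l, hl.congr fun t => Finset.sum_congr rfl fun k _ => ?_⟩
  simp only [G, R]
  rw [div_eq_inv_mul]

/-- The sum of adapted random variables with values in `[0, 1]` is asymptotic to the sum of their
conditional expectations, where the latter diverges. -/
theorem ae_tendsto_sum_div_sum_condExp (hx : ∀ t, StronglyMeasurable[ℱ (t + 1)] (x t))
    (hx0 : ∀ t ω, 0 ≤ x t ω) (hx1 : ∀ t ω, x t ω ≤ 1) :
    ∀ᵐ ω ∂μ, Tendsto (fun t => ∑ k ∈ Finset.range t, (μ[x k|ℱ k]) ω) atTop atTop →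
      Tendsto (fun t => (∑ k ∈ Finset.range t, x k ω) /
        ∑ k ∈ Finset.range t, (μ[x k|ℱ k]) ω) atTop (𝓝 1) := by
  have hxi : ∀ t, Integrable (x t) μ := fun t =>
    Integrable.of_bound ((hx t).mono (ℱ.le _)).aestronglyMeasurable 1
      (Eventually.of_forall fun ω => by rw [Real.norm_of_nonneg (hx0 t ω)]; exact hx1 t ω)
  -- A version of the conditional expectations with values in `[0, 1]` everywhere.
  let r : ℕ → Ω → ℝ := fun t ω => max 0 (min 1 ((μ[x t|ℱ t]) ω))
  have hxr : ∀ t, μ[x t|ℱ t] =ᵐ[μ] r t := by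
    intro t
    have h0 : 0 ≤ᵐ[μ] μ[x t|ℱ t] := condExp_nonneg (Eventually.of_forall (hx0 t))
    have h1 : μ[x t|ℱ t] ≤ᵐ[μ] fun _ => (1 : ℝ) := by
      have := condExp_mono (m := ℱ t) (hxi t) (integrable_const (1 : ℝ))
        (Eventually.of_forall (hx1 t))
      rwa [condExp_const (ℱ.le t)] at this
    filter_upwards [h0, h1] with ω e0 e1
    simp only [r]
    rw [min_eq_right e1]
    exact (max_eq_right e0).symm
  have hr : ∀ t, StronglyMeasurable[ℱ t] (r t) := fun t =>
    (continuous_const.max (continuous_const.min continuous_id)).comp_stronglyMeasurable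
      stronglyMeasurable_condExp
  have hr0 : ∀ t ω, 0 ≤ r t ω := fun t ω => le_max_left _ _
  have hr1 : ∀ t ω, r t ω ≤ 1 := fun t ω => max_le zero_le_one (min_le_left _ _)
  filter_upwards [ae_exists_tendsto_sum_div hx hx0 hx1 hr hr0 hr1 hxr, ae_all_iff.2 hxr]
    with ω hω heq htop
  obtain ⟨l, hl⟩ := hω
  simp only [heq] at htop ⊢
  have h := (tendsto_sum_div_of_tendsto_sum_div (d := fun k => x k ω - r k ω)
    (fun k => hr0 k ω) htop hl).add_const 1
  rw [zero_add] at h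
  refine h.congr' ?_
  filter_upwards [htop.eventually_gt_atTop 0] with t ht
  rw [Finset.sum_sub_distrib, sub_div, div_self ht.ne']
  ring

end StrongLaw

/-! ### The recursion for the empirical distributions -/

namespace Play

variable {n : ℕ} {Y Ω : Type*} {P : Play n Y Ω}

section Bookkeeping

theorem count_zero (i : Fin n) (ω : Ω) : P.count i 0 ω = 0 := rfl

theorem count_succ (i : Fin n) (t : ℕ) (ω : Ω) :
    P.count i (t + 1) ω = P.count i t ω + P.X i (t + 1) ω :=
  Finset.sum_Icc_succ_top (by omega) _

theorem monotone_count (i : Fin n) (ω : Ω) : Monotone fun t => P.count i t ω :=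
  monotone_nat_of_le_succ fun t => by rw [count_succ]; exact Nat.le_add_right _ _

theorem one_le_count {i : Fin n} {ω : Ω} (h1 : P.X i 1 ω = 1) {t : ℕ} (ht : 1 ≤ t) :
    1 ≤ P.count i t ω := by
  have h : P.count i 1 ω = 1 := by rw [count_succ, count_zero, h1]
  exact h ▸ monotone_count i ω ht

theorem responseTime_count_succ {i : Fin n} {t : ℕ} {ω : Ω} (h : P.X i (t + 1) ω = 1) :
    P.responseTime i (P.count i t ω + 1) ω = t + 1 := by
  have hmem : t + 1 ∈ {u | P.count i u ω = P.count i t ω + 1} := by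
    rw [Set.mem_ofPred_eq, count_succ, h]
  refine le_antisymm (Nat.sInf_le hmem) ?_
  by_contra hlt
  have h1 : P.count i (P.responseTime i (P.count i t ω + 1) ω) ω = P.count i t ω + 1 :=
    Nat.sInf_mem ⟨_, hmem⟩
  have h2 := monotone_count (P := P) i ω (Nat.lt_succ_iff.1 (not_le.1 hlt))
  simp only at h2
  omega

/-- The sum over the list of deliberate best responses, as a recursion over the rounds. -/
theorem sum_responseTime_succ {E : Type*} [AddCommMonoid E] {i : Fin n} {ω : Ω} (t : ℕ)
    (hX : P.X i (t + 1) ω = 0 ∨ P.X i (t + 1) ω = 1) (F : ℕ → E) :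
    ∑ s : Fin (P.count i (t + 1) ω), F (P.responseTime i ((s : ℕ) + 1) ω) =
      ∑ s : Fin (P.count i t ω), F (P.responseTime i ((s : ℕ) + 1) ω) +
        P.X i (t + 1) ω • F (t + 1) := by
  rw [Fin.sum_univ_eq_sum_range (fun s => F (P.responseTime i (s + 1) ω)),
    Fin.sum_univ_eq_sum_range (fun s => F (P.responseTime i (s + 1) ω)), count_succ]
  rcases hX with h | h
  · simp [h]
  · rw [h, Finset.sum_range_succ, responseTime_count_succ h, one_smul]

/-- The length of the step of player `i` from round `t` to round `t + 1`, see `empirical_succ`. -/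
def stepSize (P : Play n Y Ω) (i : Fin n) (t : ℕ) (ω : Ω) : ℝ :=
  P.X i (t + 1) ω / P.count i (t + 1) ω

theorem stepSize_nonneg (i : Fin n) (t : ℕ) (ω : Ω) : 0 ≤ P.stepSize i t ω := by
  unfold stepSize; positivity

/-- The step sizes are the increments of the clock `harmonic (P.count i t ω)`. -/
theorem harmonic_count_succ_sub {i : Fin n} {t : ℕ} {ω : Ω}
    (hX : P.X i (t + 1) ω = 0 ∨ P.X i (t + 1) ω = 1) :
    ((harmonic (P.count i (t + 1) ω) : ℚ) : ℝ) - (harmonic (P.count i t ω) : ℚ) =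
      P.stepSize i t ω := by
  rw [stepSize, count_succ]
  rcases hX with h | h
  · simp [h]
  · rw [h, harmonic_succ]; simp

theorem tendsto_stepSize {ω : Ω} (hX : ∀ i t, P.X i t ω = 0 ∨ P.X i t ω = 1) {i : Fin n}
    (hcount : Tendsto (fun t => (P.count i t ω : ℝ)) atTop atTop) :
    Tendsto (fun t => P.stepSize i t ω) atTop (𝓝 0) := by
  refine squeeze_zero (fun t => stepSize_nonneg i t ω) (fun t => ?_)
    ((tendsto_inv_atTop_zero.comp hcount).comp (tendsto_add_atTop_nat 1))
  simp only [Function.comp_apply, stepSize, div_eq_mul_inv]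
  refine mul_le_of_le_one_left (by positivity) ?_
  rcases hX i (t + 1) with h | h <;> simp [h]

/-- Asymptotically equal numbers of best responses synchronize the clocks. -/
theorem tendsto_harmonic_count_sub {ω : Ω} {i j : Fin n}
    (hi : Tendsto (fun t => (P.count i t ω : ℝ)) atTop atTop)
    (hj : Tendsto (fun t => (P.count j t ω : ℝ)) atTop atTop)
    (hratio : Tendsto (fun t => (P.count i t ω : ℝ) / P.count j t ω) atTop (𝓝 1)) :
    Tendsto (fun t => ((harmonic (P.count i t ω) : ℚ) : ℝ) - (harmonic (P.count j t ω) : ℚ))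
      atTop (𝓝 0) := by
  have h1 := Real.tendsto_harmonic_sub_log.comp (tendsto_natCast_atTop_iff.1 hi)
  have h2 := Real.tendsto_harmonic_sub_log.comp (tendsto_natCast_atTop_iff.1 hj)
  have h3 : Tendsto (fun t => Real.log ((P.count i t ω : ℝ) / P.count j t ω)) atTop (𝓝 0) := by
    simpa using hratio.log one_ne_zero
  have h4 := (h1.sub h2).add h3
  rw [sub_self, zero_add] at h4
  refine h4.congr' ?_
  filter_upwards [hi.eventually_gt_atTop 0, hj.eventually_gt_atTop 0] with t e1 e2
  rw [Real.log_div e1.ne' e2.ne']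
  simp only [Function.comp_apply]
  ring

variable [DecidableEq Y]

theorem empirical_mem_stdSimplex [Fintype Y] {f : Fin n → Profile n Y → Y → ℝ} {i : Fin n} {t : ℕ}
    {ω : Ω} (h : 1 ≤ P.count i t ω) : P.empirical (ecfp n Y f) t ω i ∈ stdSimplex ℝ Y := by
  have h0 : (P.count i t ω : ℝ) ≠ 0 := by exact_mod_cast (by omega : P.count i t ω ≠ 0)
  have : P.empirical (ecfp n Y f) t ω i = ∑ s : Fin (P.count i t ω),
      (1 / (P.count i t ω : ℝ)) • pureStrategy (P.a i (P.responseTime i ((s : ℕ) + 1) ω) ω) := by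
    rw [← Finset.smul_sum]; rfl
  rw [this]
  exact (convex_stdSimplex ℝ Y).sum_mem (fun _ _ => by positivity) (by simp [h0])
    fun _ _ => pureStrategy_mem_stdSimplex _

theorem empirical_succ [Fintype Y] {f : Fin n → Profile n Y → Y → ℝ} {i : Fin n} {t : ℕ} {ω : Ω}
    (h : 1 ≤ P.count i t ω) (hX : P.X i (t + 1) ω = 0 ∨ P.X i (t + 1) ω = 1) :
    P.empirical (ecfp n Y f) (t + 1) ω i = P.empirical (ecfp n Y f) t ω i +
      P.stepSize i t ω • (pureStrategy (P.a i (t + 1) ω) - P.empirical (ecfp n Y f) t ω i) := by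
  have h0 : (P.count i t ω : ℝ) ≠ 0 := by exact_mod_cast (by omega : P.count i t ω ≠ 0)
  have hsum := sum_responseTime_succ t hX fun u => (pureStrategy (P.a i u ω) : Y → ℝ)
  have e1 : P.empirical (ecfp n Y f) (t + 1) ω i = (1 / (P.count i (t + 1) ω : ℝ)) •
      ∑ s : Fin (P.count i (t + 1) ω),
        pureStrategy (P.a i (P.responseTime i ((s : ℕ) + 1) ω) ω) := rfl
  have e2 : P.empirical (ecfp n Y f) t ω i = (1 / (P.count i t ω : ℝ)) •
      ∑ s : Fin (P.count i t ω),
        pureStrategy (P.a i (P.responseTime i ((s : ℕ) + 1) ω) ω) := rfl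
  rw [e1, e2, hsum, stepSize, count_succ]
  generalize ∑ s : Fin (P.count i t ω),
    (pureStrategy (P.a i (P.responseTime i ((s : ℕ) + 1) ω) ω) : Y → ℝ) = S
  have h1 : ((P.count i t ω + P.X i (t + 1) ω : ℕ) : ℝ) ≠ 0 := by
    exact_mod_cast (by omega : P.count i t ω + P.X i (t + 1) ω ≠ 0)
  ext y
  simp only [Pi.add_apply, Pi.smul_apply, Pi.sub_apply, smul_eq_mul, nsmul_eq_mul, Pi.mul_apply,
    Pi.natCast_apply]
  push_cast at h1 ⊢
  field_simp
  ring

end Bookkeeping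

/-! ### Convergence along a path -/

section Pathwise

variable [Fintype Y] [DecidableEq Y]

/-- Along a path of the process on which the numbers of deliberate best responses of the players
diverge and are asymptotically equal, the gaps at the centroid tend to `0`. -/
theorem tendsto_gap_empirical [Nonempty Y] {Γ : Game n Y} (h_ident : Γ.Identical)
    (h_perm : Γ.PermutationInvariant) {η : ℕ → ℝ} (h_eta : Tendsto η atTop (𝓝 0))
    {f : Fin n → Profile n Y → Y → ℝ} {ω : Ω} (hX : ∀ i t, P.X i t ω = 0 ∨ P.X i t ω = 1)
    (hX1 : ∀ i, P.X i 1 ω = 1)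
    (hbest : ∀ i t, 1 ≤ t → P.b i t ω ∈ Γ.bestResponse (η (t + 1)) i
      fun _ => centroid (P.empirical (ecfp n Y f) t ω))
    (hab : ∀ i t, 1 ≤ t → P.X i (t + 1) ω = 1 → P.a i (t + 1) ω = P.b i t ω)
    (hcount : ∀ i, Tendsto (fun t => (P.count i t ω : ℝ)) atTop atTop)
    (hratio : ∀ i j, Tendsto (fun t => (P.count i t ω : ℝ) / P.count j t ω) atTop (𝓝 1))
    (i j : Fin n) :
    Tendsto (fun t => Γ.gap i (P.empirical (ecfp n Y f) t ω j)
      (centroid (P.empirical (ecfp n Y f) t ω))) atTop (𝓝 0) := by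
  -- In round `0` there is no empirical distribution, so that time is shifted by one.
  set q : ℕ → Profile n Y := fun t => P.empirical (ecfp n Y f) (t + 1) ω with hq
  have hone : ∀ j t, 1 ≤ P.count j (t + 1) ω := fun j t => one_le_count (hX1 j) (by omega)
  have hqm : ∀ t, q t ∈ mixedProfiles n Y := fun t j => empirical_mem_stdSimplex (hone j t)
  have hqc : ∀ t, centroid (q t) ∈ stdSimplex ℝ Y := fun t => centroid_mem_stdSimplex i (hqm t)
  set α : ℕ → Fin n → ℝ := fun t j => P.stepSize j (t + 1) ω with hα
  have hα0 : ∀ t j, 0 ≤ α t j := fun t j => stepSize_nonneg j _ ω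
  have hαlim : ∀ j, Tendsto (fun t => α t j) atTop (𝓝 0) := fun j =>
    (tendsto_stepSize hX (hcount j)).comp (tendsto_add_atTop_nat 1)
  set h : Fin n → ℕ → ℝ := fun j t => ((harmonic (P.count j (t + 1) ω) : ℚ) : ℝ) with hh
  have hinc : ∀ j t, h j (t + 1) - h j t = α t j := fun j t => harmonic_count_succ_sub (hX j _)
  have hstep : ∀ t j, q (t + 1) j = q t j + α t j • (pureStrategy (P.b j (t + 1) ω) - q t j) := by
    intro t j
    rcases hX j (t + 2) with h0 | h1
    · have : α t j = 0 := by simp [hα, stepSize, h0]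
      have h2 := empirical_succ (f := f) (hone j t) (hX j (t + 2))
      rw [show P.stepSize j (t + 1) ω = 0 from this] at h2
      rw [this, zero_smul]
      rwa [zero_smul] at h2
    · rw [← hab j (t + 1) (by omega) h1]
      exact empirical_succ (hone j t) (hX j (t + 2))
  have hmove : ∀ t j, ‖q (t + 1) j - q t j‖ ≤ α t j := fun t j => by
    rw [hstep, add_sub_cancel_left, norm_smul, Real.norm_of_nonneg (hα0 t j)]
    exact mul_le_of_le_one_right (hα0 t j)
      (norm_sub_le_one_of_mem_stdSimplex (pureStrategy_mem_stdSimplex _) (hqm t j))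
  have hshift : Tendsto (fun t => Γ.gap i (q t j) (centroid (q t))) atTop (𝓝 0) := by
    obtain ⟨K, hK0, hK⟩ := Γ.exists_gap_lipschitz i
    obtain ⟨B₁, hB₁⟩ := ((isCompact_stdSimplex ℝ Y).prod
      (isCompact_stdSimplex ℝ Y)).exists_bound_of_continuousOn (Γ.continuousOn_gap i)
    obtain ⟨B₂, hB₂⟩ := (isCompact_stdSimplex ℝ Y).exists_bound_of_continuousOn
      (contDiff_potential Γ i).continuous.continuousOn
    obtain ⟨s, hs, hlevel⟩ := Game.exists_dense_levels h_perm i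
    refine tendsto_gap_zero i (h := h) (gap := fun j t => Γ.gap i (q t j) (centroid (q t)))
      (v := fun t => Γ.potential i (centroid (q t))) (K := 2 * K) (B := max B₁ B₂)
      ?_ ?_ ?_ ?_ ?_ ?_ ?_ ?_ ?_ hs ?_ j
    · exact fun j => monotone_nat_of_le_succ fun t => sub_nonneg.1 (hinc j t ▸ hα0 t j)
    · exact fun j => (tendsto_harmonic_count_sub (hcount j) (hcount i) (hratio j i)).comp
        (tendsto_add_atTop_nat 1)
    · have h1 : Tendsto (fun t => Real.log (P.count i (t + 1) ω)) atTop atTop :=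
        Real.tendsto_log_atTop.comp ((hcount i).comp (tendsto_add_atTop_nat 1))
      refine tendsto_atTop_mono (fun t => ?_) h1
      refine le_trans ?_ (log_add_one_le_harmonic _)
      have : (0 : ℝ) < P.count i (t + 1) ω := by exact_mod_cast hone i t
      exact Real.log_le_log this (by push_cast; linarith)
    · simp only [hinc]
      exact hαlim i
    · exact fun j t => Γ.gap_nonneg i _ (hqm t j)
    · exact fun j t => (le_abs_self _).trans
        ((hB₁ (q t j, centroid (q t)) ⟨hqm t j, hqc t⟩).trans (le_max_left _ _))
    · exact fun t => (hB₂ _ (hqc t)).trans (le_max_right _ _)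
    · intro ε hε
      obtain ⟨δ, hδ, H⟩ := Game.exists_potential_ascent h_ident h_perm i hε
      have h1 : Tendsto (fun t => ∑ j, α t j) atTop (𝓝 0) := by
        simpa using tendsto_finsetSum Finset.univ fun j _ => hαlim j
      filter_upwards [h1.eventually_lt_const hδ,
        (h_eta.comp (tendsto_add_atTop_nat 2)).eventually_lt_const hδ] with t e1 e2
      simp only [hinc]
      exact H (q t) (hqm t) (q (t + 1)) (hqm (t + 1)) (α t) (fun j => P.b j (t + 1) ω)
        (η (t + 2)) (hα0 t) e1 e2 (hstep t) fun j => hbest j (t + 1) (by omega)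
    · intro j t
      simp only [hinc]
      refine (hK _ (hqm t j) _ (hqc t) _ (hqm (t + 1) j) _ (hqc (t + 1))).trans ?_
      have h1 := hmove t j
      have h2 := norm_centroid_sub_le i (hα0 t) (hmove t)
      have h3 : α t j ≤ ∑ j, α t j :=
        Finset.single_le_sum (fun j _ => hα0 t j) (Finset.mem_univ j)
      calc K * (‖q (t + 1) j - q t j‖ + ‖centroid (q (t + 1)) - centroid (q t)‖)
          ≤ K * (∑ j, α t j + ∑ j, α t j) := by gcongr; exact h1.trans h3
        _ = 2 * K * ∑ j, α t j := by ring
    · intro c hc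
      obtain ⟨κ, hκ, δ, hδ, H⟩ := hlevel c hc
      exact ⟨κ, hκ, δ, hδ, fun t => H (q t) (hqm t)⟩
  exact (tendsto_add_atTop_iff_nat 1).1 hshift

end Pathwise

end Play

/-! ### Consequences of the conditional laws -/

namespace Play

section Measurability

variable {n : ℕ} {Y Ω : Type*} {P : Play n Y Ω}

theorem ae_notMem_of_condExp_indicator_eq_zero {m m0 : MeasurableSpace Ω} {μ : Measure Ω}
    [IsFiniteMeasure μ] (hm : m ≤ m0) {A E : Set Ω} (hA : MeasurableSet[m0] A)
    (hE : MeasurableSet[m] E)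
    (h : ∀ᵐ ω ∂μ, ω ∈ E → (μ[A.indicator (fun _ => (1 : ℝ))|m]) ω = 0) :
    ∀ᵐ ω ∂μ, ω ∈ E → ω ∉ A := by
  have h1 := setIntegral_condExp (μ := μ) hm ((integrable_const (1 : ℝ)).indicator hA) hE
  rw [setIntegral_congr_ae (g := fun _ => (0 : ℝ)) (hm _ hE) h, integral_zero,
    integral_indicator_const _ hA, smul_eq_mul, mul_one, eq_comm,
    measureReal_eq_zero_iff, Measure.restrict_apply hA] at h1
  filter_upwards [measure_eq_zero_iff_ae_notMem.1 h1] with ω hω hωE hωA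
  exact hω ⟨hωA, hωE⟩

theorem comap_le_history (P : Play n Y Ω) (i : Fin n) {s t : ℕ} (hs : 1 ≤ s) (hst : s ≤ t) :
    MeasurableSpace.comap (P.a i s) ⊤ ⊔ MeasurableSpace.comap (P.X i s) ⊤ ⊔
      MeasurableSpace.comap (P.b i s) ⊤ ≤ P.history t :=
  le_iSup₂_of_le s (Finset.mem_Icc.2 ⟨hs, hst⟩) (le_iSup
    (fun i => MeasurableSpace.comap (P.a i s) ⊤ ⊔ MeasurableSpace.comap (P.X i s) ⊤ ⊔
      MeasurableSpace.comap (P.b i s) ⊤) i)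

theorem history_mono (P : Play n Y Ω) : Monotone P.history := by
  intro s t hst
  exact iSup₂_le fun u hu => iSup_le fun i =>
    comap_le_history P i (Finset.mem_Icc.1 hu).1 ((Finset.mem_Icc.1 hu).2.trans hst)

variable [MeasurableSpace Ω] {μ : Measure Ω} [Fintype Y] [DecidableEq Y] {Γ : Game n Y}
  {Ψ : FPAlgorithm n Y} {η : ℕ → ℝ}

theorem IsStrongVariant.history_le (h : P.IsStrongVariant μ Γ Ψ η) (t : ℕ) :
    P.history t ≤ (inferInstance : MeasurableSpace Ω) :=
  iSup₂_le fun s _ => iSup_le fun i => sup_le (sup_le (h.measurable_a i s).comap_le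
    (h.measurable_X i s).comap_le) (h.measurable_b i s).comap_le

/-- The filtration `F_t` of the process. -/
def IsStrongVariant.filtration (h : P.IsStrongVariant μ Γ Ψ η) :
    Filtration ℕ (inferInstance : MeasurableSpace Ω) where
  seq := P.history
  mono' := P.history_mono
  le' := h.history_le

/-- A deliberate best response is played: on `X_i(t+1) = 1` the conditional law of `a_i(t+1)` is the
point mass at `b_i(t)`. -/
theorem IsStrongVariant.ae_action_eq [IsProbabilityMeasure μ] (h : P.IsStrongVariant μ Γ Ψ η)
    (i : Fin n) {t : ℕ} (ht : 1 ≤ t) :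
    ∀ᵐ ω ∂μ, P.X i (t + 1) ω = 1 → P.a i (t + 1) ω = P.b i t ω := by
  have key : ∀ y : Y, ∀ᵐ ω ∂μ, P.X i (t + 1) ω = 1 → P.b i t ω ≠ y → P.a i (t + 1) ω ≠ y := by
    intro y
    have hle : P.history t ⊔ MeasurableSpace.comap (P.X i (t + 1)) ⊤ ≤
        (inferInstance : MeasurableSpace Ω) :=
      sup_le (h.history_le t) (h.measurable_X i (t + 1)).comap_le
    have hE : MeasurableSet[P.history t ⊔ MeasurableSpace.comap (P.X i (t + 1)) ⊤]
        ({ω | P.X i (t + 1) ω = 1} ∩ {ω | P.b i t ω ≠ y}) := by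
      refine MeasurableSet.inter ?_ ?_
      · exact (le_sup_right : _ ≤ P.history t ⊔ _) _ ⟨{1}, trivial, rfl⟩
      · exact (le_sup_right.trans ((comap_le_history P i ht le_rfl).trans
          (le_sup_left : _ ≤ _ ⊔ MeasurableSpace.comap (P.X i (t + 1)) ⊤))) _ ⟨{y}ᶜ, trivial, rfl⟩
    have hA : MeasurableSet {ω | P.a i (t + 1) ω = y} :=
      h.measurable_a i (t + 1) (show MeasurableSet[⊤] {y} from trivial)
    have hzero := ae_notMem_of_condExp_indicator_eq_zero (μ := μ) hle hA hE (by
      filter_upwards [h.action_rule i t ht y] with ω hω hωE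
      have hX : P.X i (t + 1) ω = 1 := hωE.1
      have hb : P.b i t ω ≠ y := hωE.2
      rw [hω, if_pos hX, pureStrategy, Pi.single_eq_of_ne hb.symm])
    filter_upwards [hzero] with ω hω hX hb
    exact hω ⟨hX, hb⟩
  filter_upwards [ae_all_iff.2 key] with ω hω hX
  by_contra hne
  exact hω (P.a i (t + 1) ω) hX (Ne.symm hne) rfl

/-- The number of deliberate best responses of a player is asymptotic to the sum of their
conditional probabilities. -/
theorem IsStrongVariant.ae_tendsto_count_div [IsProbabilityMeasure μ]
    (h : P.IsStrongVariant μ Γ Ψ η) (i : Fin n) :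
    ∀ᵐ ω ∂μ, Tendsto (fun t => ∑ k ∈ Finset.Icc 1 t, P.rho μ i k ω) atTop atTop →
      Tendsto (fun t => (P.count i t ω : ℝ) / ∑ k ∈ Finset.Icc 1 t, P.rho μ i k ω)
        atTop (𝓝 1) := by
  let x : ℕ → Ω → ℝ := fun k => Set.indicator {ω | P.X i (k + 1) ω = 1} (fun _ => (1 : ℝ))
  have hx : ∀ k, StronglyMeasurable[h.filtration (k + 1)] (x k) := fun k => by
    have hm : MeasurableSet[P.history (k + 1)] {ω | P.X i (k + 1) ω = 1} :=
      ((le_sup_right.trans le_sup_left).trans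
        (comap_le_history P i (Nat.le_add_left 1 k) le_rfl)) _ ⟨{1}, trivial, rfl⟩
    exact (@stronglyMeasurable_const _ _ (P.history (k + 1)) _ (1 : ℝ)).indicator hm
  have hx0 : ∀ k ω, 0 ≤ x k ω := fun k ω => Set.indicator_nonneg (fun _ _ => zero_le_one) ω
  have hx1 : ∀ k ω, x k ω ≤ 1 := fun k ω =>
    Set.indicator_le_self' (fun _ _ => zero_le_one) ω
  filter_upwards [ae_tendsto_sum_div_sum_condExp (μ := μ) hx hx0 hx1] with ω hω
  have hcount : ∀ t, (P.count i t ω : ℝ) = ∑ k ∈ Finset.range t, x k ω := by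
    intro t
    induction t with
    | zero => simp [count_zero]
    | succ t ih =>
      rw [count_succ, Finset.sum_range_succ, ← ih, Nat.cast_add]
      rcases h.X_mem i (t + 1) ω with h0 | h1
      · simp [x, h0]
      · simp [x, h1]
  have hrho : ∀ t, ∑ k ∈ Finset.Icc 1 t, P.rho μ i k ω =
      ∑ k ∈ Finset.range t, (μ[x k|h.filtration k]) ω := by
    intro t
    induction t with
    | zero => simp
    | succ t ih =>
      rw [Finset.sum_Icc_succ_top (by omega), ih, Finset.sum_range_succ]
      rfl
  simp only [hcount, hrho]
  exact hω

end Measurability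

end Play

/-! ### Distance to the equilibrium sets -/

section Distance

variable {n : ℕ} {Y : Type*}

theorem centroid_of_forall_eq {p : Profile n Y} (hp : ∀ i j, p i = p j) (i : Fin n) :
    centroid p = p i := by
  have hn : (n : ℝ) ≠ 0 := by exact_mod_cast (Fin.pos i).ne'
  rw [centroid, Finset.sum_congr rfl fun j _ => hp j i]
  ext y
  simp [hn]

theorem continuous_toEuclidean :
    Continuous (Profile.toEuclidean : Profile n Y → EuclideanSpace ℝ (Fin n × Y)) :=
  (PiLp.continuous_toLp 2 _).comp (by fun_prop)

variable [Fintype Y]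

/-- On a compact set, a continuous nonnegative function is small only near its zeros. If a sequence
makes it tend to `0`, then there are zeros, so that the convention for the empty set is not used. -/
theorem tendsto_distToSet_of_tendsto_zero {K S : Set (Profile n Y)} (hK : IsCompact K)
    {G : Profile n Y → ℝ} (hG : ContinuousOn G K) (h0 : ∀ p ∈ K, 0 ≤ G p)
    (hS : ∀ p ∈ K, G p = 0 → p ∈ S) {p : ℕ → Profile n Y} (hp : ∀ᶠ t in atTop, p t ∈ K)
    (hlim : Tendsto (fun t => G (p t)) atTop (𝓝 0)) :
    Tendsto (fun t => distToSet (p t) S) atTop (𝓝 0) := by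
  refine ENNReal.tendsto_nhds_zero.2 fun ε hε => ?_
  have hcont : Continuous fun p : Profile n Y => distToSet p S :=
    Metric.continuous_infEDist.comp continuous_toEuclidean
  have hK' : IsCompact (K ∩ {p | ε ≤ distToSet p S}) :=
    hK.inter_right (isClosed_le continuous_const hcont)
  rcases (K ∩ {p | ε ≤ distToSet p S}).eq_empty_or_nonempty with hemp | hne
  · filter_upwards [hp] with t ht
    by_contra hlt
    exact hemp.subset (⟨ht, (not_le.1 hlt).le⟩ : p t ∈ K ∩ {p | ε ≤ distToSet p S})
  · obtain ⟨p₀, hp₀, hmin⟩ := hK'.exists_isMinOn hne (hG.mono Set.inter_subset_left)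
    have hpos : 0 < G p₀ := by
      refine lt_of_le_of_ne (h0 p₀ hp₀.1) fun h => ?_
      have h1 : distToSet p₀ S = 0 :=
        Metric.infEDist_zero_of_mem ⟨p₀, hS p₀ hp₀.1 h.symm, rfl⟩
      exact absurd hp₀.2 (by rw [Set.mem_ofPred_eq, h1]; exact not_le.2 hε)
    filter_upwards [hp, hlim.eventually_lt_const hpos] with t ht hlt
    by_contra hgt
    exact absurd (hmin ⟨ht, (not_le.1 hgt).le⟩) (not_le.2 hlt)

theorem tendsto_distToSet_of_tendsto_sub {S : Set (Profile n Y)} {p p' : ℕ → Profile n Y}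
    (h : Tendsto (fun t => distToSet (p t) S) atTop (𝓝 0))
    (hsub : Tendsto (fun t => p' t - p t) atTop (𝓝 0)) :
    Tendsto (fun t => distToSet (p' t) S) atTop (𝓝 0) := by
  have h1 : Tendsto (fun t => edist (p' t).toEuclidean (p t).toEuclidean) atTop (𝓝 0) := by
    have h2 := ((continuous_enorm.comp continuous_toEuclidean).tendsto
      (0 : Profile n Y)).comp hsub
    have h3 : (Profile.toEuclidean (0 : Profile n Y)) = 0 := by
      ext k; simp [Profile.toEuclidean]
    simp only [Function.comp_apply, h3, enorm_zero] at h2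
    refine h2.congr fun t => ?_
    rw [edist_eq_enorm_sub]
    rfl
  refine tendsto_of_tendsto_of_tendsto_of_le_of_le tendsto_const_nhds (by simpa using h.add h1)
    (fun _ => zero_le) fun t => ?_
  exact Metric.infEDist_le_infEDist_add_edist

/-- A mean-centric equilibrium in which all players agree is a consensus equilibrium. -/
theorem Game.mem_consensusEquilibria_of_mem_meanCentricEquilibria {Γ : Game n Y}
    {p : Profile n Y} (h : p ∈ Γ.meanCentricEquilibria) (hp : ∀ i j, p i = p j) :
    p ∈ Γ.consensusEquilibria := by
  refine ⟨⟨h.1, fun i x hx => ?_⟩, hp⟩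
  have h1 := h.2 i x hx
  have h2 : (fun _ : Fin n => centroid p) = p := funext fun j => centroid_of_forall_eq hp j
  rwa [h2] at h1

theorem tendsto_distToSet_of_isEmpty [IsEmpty (Fin n)] {S : Set (Profile n Y)} (hS : S.Nonempty)
    (p : ℕ → Profile n Y) : Tendsto (fun t => distToSet (p t) S) atTop (𝓝 0) := by
  obtain ⟨s, hs⟩ := hS
  have : ∀ t, distToSet (p t) S = 0 := fun t =>
    Metric.infEDist_zero_of_mem ⟨s, hs, congrArg _ (Subsingleton.elim s (p t))⟩
  simp [this]

end Distance

/-! ### Almost sure convergence -/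

section Convergence

variable {n : ℕ} {Y Ω : Type*} [Fintype Y] [DecidableEq Y] {P : Play n Y Ω} [MeasurableSpace Ω]
  {μ : Measure Ω} {Γ : Game n Y} {η : ℕ → ℝ} {f : Fin n → Profile n Y → Y → ℝ}

/-- Since `ρ → 0`, the mixed strategies approach the learning distributions. -/
theorem Play.tendsto_strategy_sub_learning {Ψ : FPAlgorithm n Y} {ω : Ω}
    (hrho : ∀ i, Tendsto (fun t => P.rho μ i t ω) atTop (𝓝 0))
    (hmem : ∀ t, 1 ≤ t → P.learning Ψ t ω ∈ mixedProfiles n Y) :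
    Tendsto (fun t => P.strategy μ Ψ (t + 1) ω - P.learning Ψ t ω) atTop (𝓝 0) := by
  refine tendsto_pi_nhds.2 fun i => ?_
  refine squeeze_zero_norm' (a := fun t => |P.rho μ i (t + 1) ω|) ?_
    (by simpa using ((hrho i).comp (tendsto_add_atTop_nat 1)).abs)
  filter_upwards [eventually_ge_atTop 1] with t ht
  have : (P.strategy μ Ψ (t + 1) ω - P.learning Ψ t ω) i =
      P.rho μ i (t + 1) ω • (pureStrategy (P.b i t ω) - P.learning Ψ t ω i) := by
    simp only [Play.strategy, Pi.sub_apply, Nat.add_sub_cancel]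
    module
  rw [this, norm_smul, Real.norm_eq_abs]
  exact mul_le_of_le_one_right (abs_nonneg _)
    (norm_sub_le_one_of_mem_stdSimplex (pureStrategy_mem_stdSimplex _) (hmem t ht i))

variable [IsProbabilityMeasure μ]

/-- Almost surely, the gaps at the centroid of the empirical distributions tend to `0`, whatever the
convergence maps are. -/
theorem Play.IsStrongVariant.ae_tendsto_gap [Nonempty Y] (h : P.IsStrongVariant μ Γ (ecfp n Y f) η)
    (h_ident : Γ.Identical) (h_perm : Γ.PermutationInvariant)
    (h_rho_sum : ∀ i, ∀ᵐ ω ∂μ,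
      Tendsto (fun t => ∑ k ∈ Finset.Icc 1 t, P.rho μ i k ω) atTop atTop)
    (h_rho_sync : ∀ i j, ∀ᵐ ω ∂μ,
      Tendsto (fun t => (∑ k ∈ Finset.Icc 1 t, P.rho μ i k ω) /
        ∑ k ∈ Finset.Icc 1 t, P.rho μ j k ω) atTop (𝓝 1))
    (h_eta : Tendsto η atTop (𝓝 0)) :
    ∀ᵐ ω ∂μ, (∀ t, 1 ≤ t → P.empirical (ecfp n Y f) t ω ∈ mixedProfiles n Y) ∧
      ∀ i j, Tendsto (fun t => Γ.gap i (P.empirical (ecfp n Y f) t ω j)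
        (centroid (P.empirical (ecfp n Y f) t ω))) atTop (𝓝 0) := by
  have hab : ∀ᵐ ω ∂μ, ∀ i t, 1 ≤ t → P.X i (t + 1) ω = 1 → P.a i (t + 1) ω = P.b i t ω := by
    simp only [ae_all_iff]
    exact fun i t ht => h.ae_action_eq i ht
  have hbest : ∀ᵐ ω ∂μ, ∀ i t, 1 ≤ t → P.b i t ω ∈ Γ.bestResponse (η (t + 1)) i
      fun _ => centroid (P.empirical (ecfp n Y f) t ω) := by
    simp only [ae_all_iff]
    exact fun i t ht => h.best_response i t ht
  filter_upwards [hab, hbest, ae_all_iff.2 h.X_one, ae_all_iff.2 h_rho_sum,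
    ae_all_iff.2 fun i => ae_all_iff.2 (h_rho_sync i),
    ae_all_iff.2 h.ae_tendsto_count_div] with ω hab hbest hX1 hsum hsync hdiv
  have hcount : ∀ i, Tendsto (fun t => (P.count i t ω : ℝ)) atTop atTop := by
    intro i
    refine ((hdiv i (hsum i)).pos_mul_atTop zero_lt_one (hsum i)).congr' ?_
    filter_upwards [(hsum i).eventually_gt_atTop 0] with t ht
    exact div_mul_cancel₀ _ ht.ne'
  have hratio : ∀ i j, Tendsto (fun t => (P.count i t ω : ℝ) / P.count j t ω) atTop (𝓝 1) := by
    intro i j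
    have h1 := ((hdiv i (hsum i)).mul (hsync i j)).div (hdiv j (hsum j)) one_ne_zero
    rw [mul_one, div_one] at h1
    refine h1.congr' ?_
    filter_upwards [(hsum i).eventually_gt_atTop 0, (hsum j).eventually_gt_atTop 0,
      (hcount j).eventually_gt_atTop 0] with t e1 e2 e3
    have e1 := e1.ne'
    have e2 := e2.ne'
    have e3 := e3.ne'
    simp only [Pi.div_apply]
    field_simp
  exact ⟨fun t ht i => Play.empirical_mem_stdSimplex (Play.one_le_count (hX1 i) ht),
    fun i j => Play.tendsto_gap_empirical h_ident h_perm h_eta (fun i t => h.X_mem i t ω) hX1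
      hbest hab hcount hratio i j⟩

theorem Game.continuousOn_sum_gap [Nonempty Y] (Γ : Game n Y) :
    ContinuousOn (fun p : Profile n Y => ∑ i, Γ.gap i (p i) (centroid p)) (mixedProfiles n Y) :=
  continuousOn_finsetSum _ fun i _ => Γ.continuousOn_gap_centroid i i

theorem Game.sum_gap_nonneg (Γ : Game n Y) {p : Profile n Y} (hp : p ∈ mixedProfiles n Y) :
    0 ≤ ∑ i, Γ.gap i (p i) (centroid p) :=
  Finset.sum_nonneg fun i _ => Γ.gap_nonneg i _ (hp i)

theorem Game.mem_meanCentricEquilibria_of_sum_gap_eq_zero (Γ : Game n Y) {p : Profile n Y}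
    (hp : p ∈ mixedProfiles n Y) (h : ∑ i, Γ.gap i (p i) (centroid p) = 0) :
    p ∈ Γ.meanCentricEquilibria := by
  have h1 := (Finset.sum_eq_zero_iff_of_nonneg fun i _ => Γ.gap_nonneg i _ (hp i)).1 h
  exact ⟨hp, fun i x hx => Game.le_of_gap_eq_zero (h1 i (Finset.mem_univ i)) hx⟩

theorem Play.IsStrongVariant.ae_tendsto_consensusEquilibria [Nonempty Y] (i₀ : Fin n)
    (h : P.IsStrongVariant μ Γ (ecfpCentroid n Y) η)
    (h_ident : Γ.Identical) (h_perm : Γ.PermutationInvariant)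
    (h_rho_zero : ∀ i, ∀ᵐ ω ∂μ, Tendsto (fun t => P.rho μ i t ω) atTop (𝓝 0))
    (h_rho_sum : ∀ i, ∀ᵐ ω ∂μ,
      Tendsto (fun t => ∑ k ∈ Finset.Icc 1 t, P.rho μ i k ω) atTop atTop)
    (h_rho_sync : ∀ i j, ∀ᵐ ω ∂μ,
      Tendsto (fun t => (∑ k ∈ Finset.Icc 1 t, P.rho μ i k ω) /
        ∑ k ∈ Finset.Icc 1 t, P.rho μ j k ω) atTop (𝓝 1))
    (h_eta : Tendsto η atTop (𝓝 0)) :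
    ∀ᵐ ω ∂μ, Tendsto (fun t => distToSet (P.strategy μ (ecfpCentroid n Y) t ω)
      Γ.consensusEquilibria) atTop (𝓝 0) := by
  filter_upwards [h.ae_tendsto_gap h_ident h_perm h_rho_sum h_rho_sync h_eta,
    ae_all_iff.2 h_rho_zero] with ω ⟨hmem, hgap⟩ hrho
  let Ψ := ecfpCentroid n Y
  have hlearn : ∀ t i, P.learning Ψ t ω i = centroid (P.empirical Ψ t ω) := fun t i => rfl
  have heq : ∀ t i j, P.learning Ψ t ω i = P.learning Ψ t ω j := fun t i j => rfl
  have hlmem : ∀ t, 1 ≤ t → P.learning Ψ t ω ∈ mixedProfiles n Y := fun t ht i =>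
    centroid_mem_stdSimplex i₀ (hmem t ht)
  refine (tendsto_add_atTop_iff_nat 1).1 (tendsto_distToSet_of_tendsto_sub ?_
    (Play.tendsto_strategy_sub_learning hrho hlmem))
  have hclosed : IsClosed {p : Profile n Y | ∀ i j, p i = p j} := by
    simp only [Set.ofPred_forall]
    exact isClosed_iInter fun i => isClosed_iInter fun j =>
      isClosed_eq (continuous_apply i) (continuous_apply j)
  refine tendsto_distToSet_of_tendsto_zero (isCompact_mixedProfiles.inter_right hclosed)
    (Γ.continuousOn_sum_gap.mono Set.inter_subset_left) (fun p hp => Γ.sum_gap_nonneg hp.1)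
    (fun p hp h0 => Game.mem_consensusEquilibria_of_mem_meanCentricEquilibria
      (Γ.mem_meanCentricEquilibria_of_sum_gap_eq_zero hp.1 h0) hp.2) ?_ ?_
  · filter_upwards [eventually_ge_atTop 1] with t ht
    exact ⟨hlmem t ht, heq t⟩
  · -- The sum of the gaps of the centroid is the sum of the gaps of the players.
    have h1 : ∀ t, ∑ i, Γ.gap i (P.learning Ψ t ω i) (centroid (P.learning Ψ t ω)) =
        ∑ j, Γ.gap i₀ (P.empirical Ψ t ω j) (centroid (P.empirical Ψ t ω)) := by
      intro t
      rw [centroid_of_forall_eq (heq t) i₀, hlearn, Γ.sum_gap]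
      simp only [hlearn, Game.gap_eq h_ident h_perm _ i₀, Finset.sum_const, Finset.card_univ,
        Fintype.card_fin, nsmul_eq_mul]
    refine Tendsto.congr (fun t => (h1 t).symm) ?_
    have h2 := tendsto_finsetSum Finset.univ fun j _ => hgap i₀ j
    rw [Finset.sum_const_zero] at h2
    exact h2

theorem Play.IsStrongVariant.ae_tendsto_meanCentricEquilibria [Nonempty Y]
    (h : P.IsStrongVariant μ Γ (ecfpIdentity n Y) η)
    (h_ident : Γ.Identical) (h_perm : Γ.PermutationInvariant)
    (h_rho_zero : ∀ i, ∀ᵐ ω ∂μ, Tendsto (fun t => P.rho μ i t ω) atTop (𝓝 0))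
    (h_rho_sum : ∀ i, ∀ᵐ ω ∂μ,
      Tendsto (fun t => ∑ k ∈ Finset.Icc 1 t, P.rho μ i k ω) atTop atTop)
    (h_rho_sync : ∀ i j, ∀ᵐ ω ∂μ,
      Tendsto (fun t => (∑ k ∈ Finset.Icc 1 t, P.rho μ i k ω) /
        ∑ k ∈ Finset.Icc 1 t, P.rho μ j k ω) atTop (𝓝 1))
    (h_eta : Tendsto η atTop (𝓝 0)) :
    ∀ᵐ ω ∂μ, Tendsto (fun t => distToSet (P.strategy μ (ecfpIdentity n Y) t ω)
      Γ.meanCentricEquilibria) atTop (𝓝 0) := by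
  filter_upwards [h.ae_tendsto_gap h_ident h_perm h_rho_sum h_rho_sync h_eta,
    ae_all_iff.2 h_rho_zero] with ω ⟨hmem, hgap⟩ hrho
  refine (tendsto_add_atTop_iff_nat 1).1 (tendsto_distToSet_of_tendsto_sub ?_
    (Play.tendsto_strategy_sub_learning hrho hmem))
  refine tendsto_distToSet_of_tendsto_zero isCompact_mixedProfiles
    Γ.continuousOn_sum_gap (fun p hp => Γ.sum_gap_nonneg hp)
    (fun p hp h0 => Γ.mem_meanCentricEquilibria_of_sum_gap_eq_zero hp h0) ?_ ?_
  · filter_upwards [eventually_ge_atTop 1] with t ht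
    exact hmem t ht
  · have h1 := tendsto_finsetSum Finset.univ fun i _ => hgap i i
    rw [Finset.sum_const_zero] at h1
    exact h1

end Convergence

end ECFP

end

theorem mainTheorem4 {n : ℕ} {Y : Type*} [Fintype Y] [DecidableEq Y]
    (Γ : ECFP.Game n Y) (h_ident : Γ.Identical) (h_perm : Γ.PermutationInvariant)
    {Ω : Type*} [MeasurableSpace Ω] (μ : MeasureTheory.Measure Ω)
    [MeasureTheory.IsProbabilityMeasure μ] (P : ECFP.Play n Y Ω) (η : ℕ → ℝ)
    (h_rho_zero : ∀ i, ∀ᵐ ω ∂μ, Tendsto (fun t => P.rho μ i t ω) atTop (𝓝 0))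
    (h_rho_sum : ∀ i, ∀ᵐ ω ∂μ,
      Tendsto (fun t => ∑ k ∈ Finset.Icc 1 t, P.rho μ i k ω) atTop atTop)
    (h_rho_sync : ∀ i j, ∀ᵐ ω ∂μ,
      Tendsto (fun t => (∑ k ∈ Finset.Icc 1 t, P.rho μ i k ω) /
        ∑ k ∈ Finset.Icc 1 t, P.rho μ j k ω) atTop (𝓝 1))
    (h_eta : Tendsto η atTop (𝓝 0)) :
    (P.IsStrongVariant μ Γ (ECFP.ecfpCentroid n Y) η →
      ∀ᵐ ω ∂μ, Tendsto (fun t => ECFP.distToSet (P.strategy μ (ECFP.ecfpCentroid n Y) t ω)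
        Γ.consensusEquilibria) atTop (𝓝 0)) ∧
    (P.IsStrongVariant μ Γ (ECFP.ecfpIdentity n Y) η →
      ∀ᵐ ω ∂μ, Tendsto (fun t => ECFP.distToSet (P.strategy μ (ECFP.ecfpIdentity n Y) t ω)
        Γ.meanCentricEquilibria) atTop (𝓝 0)) := by
  rcases isEmpty_or_nonempty (Fin n) with hn | ⟨⟨i₀⟩⟩
  · -- Without players there is only one profile, and it is an equilibrium.
    let p₀ : ECFP.Profile n Y := fun i => isEmptyElim i
    exact ⟨fun _ => Eventually.of_forall fun ω => ECFP.tendsto_distToSet_of_isEmpty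
        (S := Γ.consensusEquilibria) ⟨p₀, ⟨⟨isEmptyElim, isEmptyElim⟩, isEmptyElim⟩⟩ _,
      fun _ => Eventually.of_forall fun ω => ECFP.tendsto_distToSet_of_isEmpty
        (S := Γ.meanCentricEquilibria) ⟨p₀, ⟨isEmptyElim, isEmptyElim⟩⟩ _⟩
  have hY : Nonempty Y := (Measure.nonempty_of_neZero μ).map (P.a i₀ 1)
  exact ⟨fun h => h.ae_tendsto_consensusEquilibria i₀ h_ident h_perm h_rho_zero h_rho_sum
      h_rho_sync h_eta,
    fun h => h.ae_tendsto_meanCentricEquilibria h_ident h_perm h_rho_zero h_rho_sum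
      h_rho_sync h_eta⟩
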